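/- Let $p$ be a prime, $G=\mathbb{F}_p^n$, and let $\mathcal A$ be the real group algebra of $G$: functions $G\to\mathbb{R}$ with convolution as product, $u^*(a)=u(-a)$, $\langle f,g\rangle=\sum_a f(a)g(a)$, $\|f\|_2^2=\langle f,f\rangle$. For $f,g\in\mathcal A$ put $d(f,g)=\bigl(\sum_a f(a)\bigr)\bigl(\sum_a g(a)\bigr)-\langle f,g\rangle$. Let $\Sigma(\mathcal A)\subset\mathcal A$ be the set of non-negative functions with sum $1$, and let $\delta_g\in\mathcal A$ be the delta function at $g$. All expectations $\mathbb{E}$ are uniform averages over $G$. Let $\beta:G\times G\to\mathbb{F}_p^k$ be bi-affine, i.e. $\beta(x,y)=\gamma(x,y)+Ax+Cy+z_0$ with $\gamma$ bilinear and $A,C$ linear. Its rank is the smallest rank of a bilinear form $(x,y)\mapsto u\cdot\gamma(x,y)$ with $0\ne u\in\mathbb{F}_p^k$ (and $\infty$ if $k=0$). Let $B=\{(x,y):\beta(x,y)=z\}$ for some $z\in\mathbb{F}_p^k$; this is a bilinear Bohr set of codimension $k$, and its rank is taken to be the rank $t$ of $\beta$. Let $\beta'(x,h)=\beta(x,y+h)-\beta(x,y)$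 (independent of $y$), $\beta''(w,h)=\beta'(x+w,h)-\beta'(x,h)$ (independent of $x$), and $B''=\{(w,h):\beta''(w,h)=0\}$; this contains every $(w,h)$ for which there is a parallelogram $(x,y),(x,y+h),(x+w,y'),(x+w,y'+h)$ in $B$. Let $0\le\eta<1/400$ and suppose that $t\ge 60k+9\log(\eta^{-1})$, where $\log$ is the natural logarithm and $\log(0^{-1})=\infty$. Let $\phi:G^2\to\mathcal A$ satisfy $\phi(x,y)\in\Sigma(\mathcal A)$ for $(x,y)\in B$ and $\phi(x,y)=0$ otherwise. Suppose that $\phi$ is a $(1-\eta)$-bihomomorphism with respect to $\mu=\mathbb 1_B$, i.e. $$\mathbb{E}_{w,h}\bigl\|\mathbb{E}_{P}\,\mu(P)\phi(P)\bigr\|_2^2\ \ge\ (1-\eta)\,\mathbb{E}_{w,h}\bigl(\mathbb{E}_{P}\,\mu(P)\bigr)^2,$$ where, for given $w,h$, $P$ is a random vertical parallelogram with vertices $(x,y_1),(x,y_1+h),(x+w,y_2),(x+w,y_2+h)$ ($x,y_1,y_2\in G$ independent and uniform), $\mu(P)$ is the product of $\mu$ over the four vertices, and $\phi(P)=\phi(x,y_1)\phi(x,y_1+h)^*\phi(x+w,y_2)^*\phi(x+w,y_2+h)$.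 Let $\psi$ be the mixed convolution of $\phi$: with $\phi_1(x,h)=\mathbb{E}_y\phi(x,y)\phi(x,y-h)^*$, $$\psi(w,h)=\mathbb{E}_x\phi_1(x,h)\phi_1(x-w,h)^*.$$ Then there is a function $\tilde\psi_2:B''\to G$, additive in each variable separately (that is, $\tilde\psi_2(w_1+w_2,h)=\tilde\psi_2(w_1,h)+\tilde\psi_2(w_2,h)$ and $\tilde\psi_2(w,h_1+h_2)=\tilde\psi_2(w,h_1)+\tilde\psi_2(w,h_2)$ whenever all points involved lie in $B''$), such that, with $\psi_2(w,h)=\delta_{\tilde\psi_2(w,h)}$ for $(w,h)\in B''$ and $\psi_2(w,h)=0$ otherwise, $$\mathbb{E}_{w,h}\,d\bigl(\psi(w,h),\psi_2(w,h)\bigr)\le 128\,\eta\,p^{-4k}.$$ -/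

import Mathlib

open scoped BigOperators ENNReal

noncomputable section

namespace BiStab

/-! ### The group algebra of a finite Abelian group

The product of `AddMonoidAlgebra ℝ G` is convolution, and `AddMonoidAlgebra.single g 1` is the
delta function at `g`. All elements of the group algebra that occur below are real-valued. -/

section GroupAlgebra

variable {G : Type*} [AddCommGroup G] [Fintype G]

/-- The delta function `δ_g`. -/
def delta (g : G) : AddMonoidAlgebra ℝ G := AddMonoidAlgebra.single g 1

/-- The adjoint `u*(a) = u(-a)`; no conjugation is needed for real coefficients. -/
def adj (u : AddMonoidAlgebra ℝ G) : AddMonoidAlgebra ℝ G :=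
  AddMonoidAlgebra.ofCoeff (Finsupp.equivFunOnFinite.symm fun a => u.coeff (-a))

/-- The sum of the values of an element of the group algebra. -/
def mass (f : AddMonoidAlgebra ℝ G) : ℝ := ∑ a, f.coeff a

/-- The inner product `⟨f, g⟩ = ∑ₐ f(a) g(a)`. -/
def innerSum (f g : AddMonoidAlgebra ℝ G) : ℝ := ∑ a, f.coeff a * g.coeff a

/-- The set `Σ(𝒜)` of non-negative functions with sum `1`. -/
def simplex (G : Type*) [AddCommGroup G] [Fintype G] : Set (AddMonoidAlgebra ℝ G) :=
  {f | (∀ a, 0 ≤ f.coeff a) ∧ mass f = 1}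

/-- The "distance" `d(f, g) = (∑ₓ f(x)) (∑ᵧ g(y)) - ⟨f, g⟩`, equal to `1 - ⟨f, g⟩` on `Σ(𝒜)`. -/
def gdist (f g : AddMonoidAlgebra ℝ G) : ℝ := mass f * mass g - innerSum f g

/-- The vertical convolution `(x, h) ↦ 𝔼_y f(x, y) g(x, y - h)*`. -/
def vertConv (f g : G → G → AddMonoidAlgebra ℝ G) : G → G → AddMonoidAlgebra ℝ G :=
  fun x h => 𝔼 y, f x y * adj (g x (y - h))

/-- The horizontal convolution `(w, y) ↦ 𝔼_x f(x, y) g(x - w, y)*`. -/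
def horizConv (f g : G → G → AddMonoidAlgebra ℝ G) : G → G → AddMonoidAlgebra ℝ G :=
  fun w y => 𝔼 x, f x y * adj (g (x - w) y)

/-- The mixed convolution of `f` (that is, of four copies of `f`). -/
def mixedConv (f : G → G → AddMonoidAlgebra ℝ G) : G → G → AddMonoidAlgebra ℝ G :=
  horizConv (vertConv f f) (vertConv f f)

/-- `φ(P)` for the vertical parallelogram `P` with vertices
`(x, y₁), (x, y₁ + h), (x + w, y₂), (x + w, y₂ + h)`. -/
def atPar (φ : G → G → AddMonoidAlgebra ℝ G) (w h x y₁ y₂ : G) : AddMonoidAlgebra ℝ G :=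
  φ x y₁ * adj (φ x (y₁ + h)) * adj (φ (x + w) y₂) * φ (x + w) (y₂ + h)

/-- `μ(P)` for the same vertical parallelogram and a real-valued `μ`. -/
def weightPar (μ : G → G → ℝ) (w h x y₁ y₂ : G) : ℝ :=
  μ x y₁ * μ x (y₁ + h) * μ (x + w) y₂ * μ (x + w) (y₂ + h)

/-- `φ` is a `(1 - η)`-bihomomorphism with respect to the weight `μ`:
`𝔼_{w,h} ‖𝔼_P μ(P) φ(P)‖₂² ≥ (1 - η) 𝔼_{w,h} (𝔼_P μ(P))²`, where `P` ranges over all vertical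
parallelograms of width `w` and height `h`. -/
def IsApproxBihom (η : ℝ) (μ : G → G → ℝ) (φ : G → G → AddMonoidAlgebra ℝ G) : Prop :=
  (1 - η) * (𝔼 w, 𝔼 h, (𝔼 x, 𝔼 y₁, 𝔼 y₂, weightPar μ w h x y₁ y₂) ^ 2) ≤
    𝔼 w, 𝔼 h,
      innerSum (𝔼 x, 𝔼 y₁, 𝔼 y₂, weightPar μ w h x y₁ y₂ • atPar φ w h x y₁ y₂)
        (𝔼 x, 𝔼 y₁, 𝔼 y₂, weightPar μ w h x y₁ y₂ • atPar φ w h x y₁ y₂)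

/-- The restriction of `f` to `S` is additive in each variable separately. The values of `f`
outside `S` play no role. -/
def SepAdditiveOn (S : Set (G × G)) (f : G → G → G) : Prop :=
  (∀ w₁ w₂ h, (w₁, h) ∈ S → (w₂, h) ∈ S → (w₁ + w₂, h) ∈ S →
    f (w₁ + w₂) h = f w₁ h + f w₂ h) ∧
  (∀ w h₁ h₂, (w, h₁) ∈ S → (w, h₂) ∈ S → (w, h₁ + h₂) ∈ S →
    f w (h₁ + h₂) = f w h₁ + f w h₂)

/-- The vertical difference set `{(x, h) : ∃ y, (x, y), (x, y + h) ∈ B}`. -/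
def vertDiffSet (B : Set (G × G)) : Set (G × G) :=
  {q | ∃ y, (q.1, y) ∈ B ∧ (q.1, y + q.2) ∈ B}

/-- The mixed difference set `{(w, h) : ∃ x, (x, h), (x + w, h) ∈ B'}`, with `B'` the vertical
difference set of `B`. -/
def mixedDiffSet (B : Set (G × G)) : Set (G × G) :=
  {q | ∃ x, (x, q.2) ∈ vertDiffSet B ∧ (x + q.1, q.2) ∈ vertDiffSet B}

end GroupAlgebra

/-! ### Bi-affine maps, rank and bilinear Bohr sets -/

/-- A bi-affine map `β(x, y) = γ(x, y) + A x + C y + z₀` from `𝔽_pⁿ × 𝔽_pⁿ` to `𝔽_pᵏ`, with `γ`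
bilinear and `A`, `C` linear. -/
structure BiAffineMap (p n k : ℕ) where
  bilin : (Fin n → ZMod p) →ₗ[ZMod p] (Fin n → ZMod p) →ₗ[ZMod p] (Fin k → ZMod p)
  left : (Fin n → ZMod p) →ₗ[ZMod p] (Fin k → ZMod p)
  right : (Fin n → ZMod p) →ₗ[ZMod p] (Fin k → ZMod p)
  const : Fin k → ZMod p

namespace BiAffineMap

variable {p n k : ℕ}

/-- The value `β(x, y)`. -/
def eval (β : BiAffineMap p n k) (x y : Fin n → ZMod p) : Fin k → ZMod p :=
  β.bilin x y + β.left x + β.right y + β.const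

/-- The bilinear form `(x, y) ↦ u.γ(x, y)`, with `γ` the bilinear part of `β`. -/
def form (β : BiAffineMap p n k) (u : Fin k → ZMod p) :
    (Fin n → ZMod p) →ₗ[ZMod p] (Fin n → ZMod p) →ₗ[ZMod p] ZMod p :=
  β.bilin.compr₂ (dotProductEquiv (ZMod p) (Fin k) u)

/-- The rank of `β`: the smallest rank of a form `u.β` with `u ≠ 0`. It is `⊤` for `k = 0`. The
rank of a form `x.Ty` is the rank of `T`, that is, of the linear map sending `x` to `y ↦ x.Ty`. -/
def rank (β : BiAffineMap p n k) : ℕ∞ :=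
  ⨅ u : Fin k → ZMod p, ⨅ _ : u ≠ 0,
    ((Module.finrank (ZMod p) (LinearMap.range (β.form u)) : ℕ) : ℕ∞)

/-- The bilinear Bohr set `{(x, y) : β(x, y) = z}`, of codimension `k`. -/
def bohrSet (β : BiAffineMap p n k) (z : Fin k → ZMod p) :
    Set ((Fin n → ZMod p) × (Fin n → ZMod p)) :=
  {q | β.eval q.1 q.2 = z}

/-- The vertical derivative `β'(x, h) = β(x, y + h) - β(x, y)`, which does not depend on `y`. -/
def vertDeriv (β : BiAffineMap p n k) (x h : Fin n → ZMod p) : Fin k → ZMod p :=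
  β.eval x h - β.eval x 0

/-- The mixed derivative `β''(w, h) = β'(x + w, h) - β'(x, h)`, which does not depend on `x`. -/
def mixedDeriv (β : BiAffineMap p n k) (w h : Fin n → ZMod p) : Fin k → ZMod p :=
  β.vertDeriv w h - β.vertDeriv 0 h

/-- The zero set `{(w, h) : β''(w, h) = 0}` of the mixed derivative. -/
def mixedZeroSet (β : BiAffineMap p n k) : Set ((Fin n → ZMod p) × (Fin n → ZMod p)) :=
  {q | β.mixedDeriv q.1 q.2 = 0}

theorem vertDeriv_eq (β : BiAffineMap p n k) (x y h : Fin n → ZMod p) :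
    β.vertDeriv x h = β.eval x (y + h) - β.eval x y := by
  simp only [vertDeriv, eval, map_add, map_zero]
  abel

theorem mixedDeriv_eq (β : BiAffineMap p n k) (x w h : Fin n → ZMod p) :
    β.mixedDeriv w h = β.vertDeriv (x + w) h - β.vertDeriv x h := by
  simp only [mixedDeriv, vertDeriv, eval, map_add, map_zero, LinearMap.add_apply,
    LinearMap.zero_apply]
  abel

/-- The zero set of the mixed derivative contains the mixed difference set of each Bohr set of
`β`. -/
theorem mixedDiffSet_subset (β : BiAffineMap p n k) (z : Fin k → ZMod p) :
    mixedDiffSet (β.bohrSet z) ⊆ β.mixedZeroSet := by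
  rintro ⟨w, h⟩ ⟨x, ⟨y, hy, hyh⟩, ⟨y', hy', hyh'⟩⟩
  simp only [bohrSet, Set.mem_ofPred_eq] at hy hyh hy' hyh'
  simp only [mixedZeroSet, Set.mem_ofPred_eq]
  rw [β.mixedDeriv_eq x, β.vertDeriv_eq (x + w) y', β.vertDeriv_eq x y, hy, hyh, hy', hyh']
  simp

end BiAffineMap

end BiStab

end

set_option linter.unusedSectionVars false

noncomputable section

namespace BiStab

/-! ### Averages and proportions over finite types. -/

section Averages

variable {ι κ : Type*} [Fintype ι] [Fintype κ]

/-! Write q = p^{-k}, which is `dens K`. The columns of B are fibres of the linear maps `L x` = γ(x,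
·) + C. For most h the row {x : L x h = 0} is a coset of the kernel of `M h` = γ(·, h). High rank
makes these maps onto even when restricted to subspaces of bounded codimension, apart from a tiny
proportion σ of indices (`prob_map_ne_top_le`, `MostlyOnto`). Hence all relevant densities are
powers of q up to O(σ), and the kernels of typical `M a` are in general position.

Concentration. Since ‖u‖² is at most the mass of u times its largest value, the hypothesis forces
ψ(w, h) to sit, on average, almost entirely at one point g(h, w) (`exists_expect_defect_le`). In a
fixed row this says that a family of probability measures has typical differences depending only on
x' - x. A majority argument (`exists_addHom_of_expect_lt`) then replaces g(h, ·) by a linear map `T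
h`, losing only O(σ). Markov's inequality discards about 6η of the rows.

Additivity in h. A parallelogram of height h₂ stacked on one of height h₁ gives one of height h₁ +
h₂, so a failure of T h₁ + T h₂ = T (h₁ + h₂) at w forces a large total defect (`colDens_mul_le`). A
linear identity that fails on a subspace fails on at least half of it, and double counting shows
that about 24η of the pairs are bad (`prob_not_addAt_le`).

Correction. As in linearity testing, one wants A h to be the common value of T a + T (h - a), but
this is visible only on ker M h ∩ ker M a. Gluing over two values of a in general position defines A
h on all of ker M h, for every h. Further general position arguments show that A is additive at all
pairs and agrees with T for most h (`exists_addAt_of_prob`). At most 41η of the rows are then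
exceptional. Each nondegenerate one costs at most its total mass, about q⁴; the other rows cost
about ηq⁴ together, and degenerate rows only O(σ). The sum is well below 128ηq⁴. -/

open Classical in
/-- The proportion of elements of a finite type that satisfy `P`. -/
def prob (P : ι → Prop) : ℝ := 𝔼 x, if P x then 1 else 0

theorem expect_mono {f g : ι → ℝ} (h : ∀ x, f x ≤ g x) : 𝔼 x, f x ≤ 𝔼 x, g x :=
  Finset.expect_le_expect fun x _ => h x

theorem expect_nonneg' {f : ι → ℝ} (h : ∀ x, 0 ≤ f x) : 0 ≤ 𝔼 x, f x :=
  Finset.expect_nonneg fun x _ => h x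

theorem expect_le_const [Nonempty ι] {f : ι → ℝ} {c : ℝ} (h : ∀ x, f x ≤ c) : 𝔼 x, f x ≤ c :=
  (expect_mono h).trans_eq (Fintype.expect_const c)

theorem exists_le_expect [Nonempty ι] (f : ι → ℝ) : ∃ x, f x ≤ 𝔼 y, f y := by
  by_contra! h
  have := Finset.expect_lt_expect (s := Finset.univ) (f := fun _ => 𝔼 y, f y) (g := f)
    (fun x _ => (h x).le) ⟨Classical.arbitrary ι, Finset.mem_univ _, h _⟩
  simp at this

theorem expect_comm' (f : ι → κ → ℝ) : 𝔼 x, 𝔼 y, f x y = 𝔼 y, 𝔼 x, f x y :=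
  Finset.expect_comm _ _ _

theorem expect_prod (f : ι → κ → ℝ) : 𝔼 z : ι × κ, f z.1 z.2 = 𝔼 x, 𝔼 y, f x y := by
  rw [← Finset.expect_product', Finset.univ_product_univ]

theorem prob_nonneg (P : ι → Prop) : 0 ≤ prob P :=
  expect_nonneg' fun x => by split_ifs <;> norm_num

theorem prob_le_one [Nonempty ι] (P : ι → Prop) : prob P ≤ 1 :=
  expect_le_const fun x => by split_ifs <;> norm_num

theorem prob_mono {P Q : ι → Prop} (h : ∀ x, P x → Q x) : prob P ≤ prob Q :=
  expect_mono fun x => by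
    by_cases hP : P x
    · simp [hP, h x hP]
    · simp only [hP, if_false]; split_ifs <;> norm_num

theorem prob_or_le (P Q : ι → Prop) : prob (fun x => P x ∨ Q x) ≤ prob P + prob Q := by
  rw [prob, prob, prob, ← Finset.expect_add_distrib]
  exact expect_mono fun x => by by_cases hP : P x <;> by_cases hQ : Q x <;> simp [hP, hQ]

theorem prob_not [Nonempty ι] (P : ι → Prop) : prob (fun x => ¬ P x) = 1 - prob P := by
  have : prob (fun x => ¬ P x) + prob P = 1 := by
    rw [prob, prob, ← Finset.expect_add_distrib]
    rw [← Fintype.expect_one (ι := ι) (M := ℝ)]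
    exact Finset.expect_congr rfl fun x _ => by by_cases hP : P x <;> simp [hP]
  linarith

theorem prob_prod (P : ι → κ → Prop) :
    prob (fun z : ι × κ => P z.1 z.2) = 𝔼 x, prob (P x) :=
  expect_prod fun x y => open Classical in if P x y then (1 : ℝ) else 0

theorem prob_equiv (e : ι ≃ κ) (P : κ → Prop) : prob (fun x => P (e x)) = prob P :=
  Fintype.expect_equiv e _ _ fun _ => rfl

theorem exists_of_prob_pos {P : ι → Prop} (h : 0 < prob P) : ∃ x, P x := by
  by_contra! hP
  simp [prob, hP] at h

theorem prob_eq_card (P : ι → Prop) : prob P = (Nat.card {x // P x} : ℝ) / Fintype.card ι := by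
  classical
  rw [prob, Fintype.expect_eq_sum_div_card, Nat.card_eq_fintype_card, Fintype.card_subtype]
  simp

/-- A function whose average is at most `a` is at most `a / b` somewhere on a set of proportion
at least `b`. -/
theorem exists_le_div_of_prob [Nonempty ι] {f : ι → ℝ} {P : ι → Prop} {a b : ℝ}
    (hf : ∀ x, 0 ≤ f x) (ha : 𝔼 x, f x ≤ a) (hb : 0 < b) (hP : b ≤ prob P) :
    ∃ x, P x ∧ f x ≤ a / b := by
  classical
  by_contra! h
  have hle : ∀ x, a / b * (if P x then 1 else 0) ≤ f x := fun x => by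
    by_cases hx : P x
    · simpa [hx] using (h x hx).le
    · simpa [hx] using hf x
  have h0 : 0 ≤ a := (expect_nonneg' hf).trans ha
  obtain ⟨x₀, hx₀⟩ := exists_of_prob_pos (hb.trans_le hP)
  have hlt : 𝔼 x, a / b * (if P x then (1 : ℝ) else 0) < 𝔼 x, f x :=
    Finset.expect_lt_expect (fun x _ => hle x)
      ⟨x₀, Finset.mem_univ _, by simpa [hx₀] using h x₀ hx₀⟩
  rw [← Finset.mul_expect] at hlt
  have : a / b * b ≤ a / b * prob P := mul_le_mul_of_nonneg_left hP (by positivity)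
  rw [div_mul_cancel₀ _ hb.ne'] at this
  have h2 : a / b * prob P < 𝔼 x, f x := hlt
  linarith

/-- Markov's inequality. -/
theorem mul_prob_le_expect {f : ι → ℝ} {P : ι → Prop} {c : ℝ} (hf : ∀ x, 0 ≤ f x)
    (h : ∀ x, P x → c ≤ f x) : c * prob P ≤ 𝔼 x, f x := by
  classical
  rw [prob, Finset.mul_expect]
  refine expect_mono fun x => ?_
  by_cases hx : P x
  · simpa [hx] using h x hx
  · simpa [hx] using hf x

theorem expect_add_right {V : Type*} [AddCommGroup V] [Fintype V] (f : V → ℝ) (a : V) :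
    𝔼 x, f (x + a) = 𝔼 x, f x :=
  Fintype.expect_equiv (Equiv.addRight a) _ _ fun _ => rfl

theorem expect_add_left {V : Type*} [AddCommGroup V] [Fintype V] (f : V → ℝ) (a : V) :
    𝔼 x, f (a + x) = 𝔼 x, f x :=
  Fintype.expect_equiv (Equiv.addLeft a) _ _ fun _ => rfl

end Averages

/-! ### Group algebra calculus and stability of approximate homomorphisms. -/

section GroupAlgebraLemmas

variable {G : Type*} [AddCommGroup G] [Fintype G]

theorem coeff_adj (u : AddMonoidAlgebra ℝ G) (a : G) : (adj u).coeff a = u.coeff (-a) := rfl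

theorem coeff_delta (g a : G) [Decidable (g = a)] :
    (delta g).coeff a = if g = a then 1 else 0 := by
  rw [delta, AddMonoidAlgebra.coeff_single, Finsupp.single_apply]

theorem coeff_mul_eq_sum (u v : AddMonoidAlgebra ℝ G) (a : G) :
    (u * v).coeff a = ∑ r, u.coeff (a - r) * v.coeff r := by
  classical
  rw [AddMonoidAlgebra.coeff_mul_antidiag u v a
    (Finset.univ.map ⟨fun r : G => (a - r, r), fun x y h => (Prod.ext_iff.1 h).2⟩)]
  · rw [Finset.sum_map]
    rfl
  · rintro ⟨x, y⟩
    simp only [Finset.mem_map, Finset.mem_univ, true_and]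
    constructor
    · rintro ⟨r, h⟩
      obtain ⟨rfl, rfl⟩ := Prod.ext_iff.1 h
      exact sub_add_cancel a r
    · rintro rfl
      exact ⟨y, Prod.ext (add_sub_cancel_right x y) rfl⟩

theorem coeff_mul_adj (u v : AddMonoidAlgebra ℝ G) (a : G) :
    (u * adj v).coeff a = ∑ r, u.coeff (a + r) * v.coeff r := by
  rw [coeff_mul_eq_sum, ← Equiv.sum_comp (Equiv.neg G)]
  simp [coeff_adj]

/-- The evaluation at `a` as a linear map. -/
def coeffHom (a : G) : AddMonoidAlgebra ℝ G →ₗ[ℝ] ℝ where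
  toFun u := u.coeff a
  map_add' u v := by simp
  map_smul' c u := by simp

/-- `mass` as a linear map. -/
def massHom : AddMonoidAlgebra ℝ G →ₗ[ℝ] ℝ where
  toFun u := mass u
  map_add' u v := by simp [mass, Finset.sum_add_distrib]
  map_smul' c u := by simp [mass, Finset.mul_sum]

theorem adj_add (u v : AddMonoidAlgebra ℝ G) : adj (u + v) = adj u + adj v := by
  ext a; simp [coeff_adj]

theorem adj_smul (c : ℝ) (u : AddMonoidAlgebra ℝ G) : adj (c • u) = c • adj u := by
  ext a; simp [coeff_adj]

/-- `adj` as a linear map. -/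
def adjHom : AddMonoidAlgebra ℝ G →ₗ[ℝ] AddMonoidAlgebra ℝ G where
  toFun := adj
  map_add' := adj_add
  map_smul' := adj_smul

variable {ι : Type*} [Fintype ι]

theorem coeff_expect (f : ι → AddMonoidAlgebra ℝ G) (a : G) :
    (𝔼 i, f i).coeff a = 𝔼 i, (f i).coeff a :=
  map_expect ((coeffHom a).restrictScalars ℚ≥0) _ _

theorem mass_expect (f : ι → AddMonoidAlgebra ℝ G) : mass (𝔼 i, f i) = 𝔼 i, mass (f i) :=
  map_expect ((massHom (G := G)).restrictScalars ℚ≥0) _ _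

theorem adj_expect (f : ι → AddMonoidAlgebra ℝ G) : adj (𝔼 i, f i) = 𝔼 i, adj (f i) :=
  map_expect ((adjHom (G := G)).restrictScalars ℚ≥0) _ _

theorem adj_zero : adj (0 : AddMonoidAlgebra ℝ G) = 0 := map_zero (adjHom (G := G))

theorem mass_zero : mass (0 : AddMonoidAlgebra ℝ G) = 0 := map_zero (massHom (G := G))

theorem mass_smul (c : ℝ) (u : AddMonoidAlgebra ℝ G) : mass (c • u) = c * mass u :=
  map_smul (massHom (G := G)) c u

theorem adj_adj (u : AddMonoidAlgebra ℝ G) : adj (adj u) = u := by ext a; simp [coeff_adj]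

theorem mass_adj (u : AddMonoidAlgebra ℝ G) : mass (adj u) = mass u := by
  rw [mass, mass, ← Equiv.sum_comp (Equiv.neg G)]
  simp [coeff_adj]

theorem mass_mul (u v : AddMonoidAlgebra ℝ G) : mass (u * v) = mass u * mass v := by
  simp only [mass, coeff_mul_eq_sum]
  rw [Finset.sum_comm, Finset.mul_sum]
  refine Finset.sum_congr rfl fun r _ => ?_
  rw [← Finset.sum_mul]
  congr 1
  exact Equiv.sum_comp (Equiv.subRight r) _

theorem adj_mul (u v : AddMonoidAlgebra ℝ G) : adj (u * v) = adj u * adj v := by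
  ext a
  rw [coeff_adj, coeff_mul_eq_sum, coeff_mul_eq_sum, ← Equiv.sum_comp (Equiv.neg G)]
  refine Finset.sum_congr rfl fun r _ => ?_
  simp only [coeff_adj, Equiv.neg_apply]
  congr 2
  abel

theorem mass_delta (g : G) : mass (delta g) = 1 := by
  classical
  simp [mass, coeff_delta]

theorem innerSum_delta (u : AddMonoidAlgebra ℝ G) (g : G) : innerSum u (delta g) = u.coeff g := by
  classical
  simp [innerSum, coeff_delta]

theorem gdist_delta (u : AddMonoidAlgebra ℝ G) (g : G) :
    gdist u (delta g) = mass u - u.coeff g := by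
  rw [gdist, mass_delta, innerSum_delta, mul_one]

theorem gdist_zero (u : AddMonoidAlgebra ℝ G) : gdist u 0 = 0 := by
  simp [gdist, innerSum, mass]

/-- The cone of non-negative elements of the group algebra. -/
def IsNonneg (u : AddMonoidAlgebra ℝ G) : Prop := ∀ a, 0 ≤ u.coeff a

theorem IsNonneg.zero : IsNonneg (0 : AddMonoidAlgebra ℝ G) := fun _ => le_rfl

theorem IsNonneg.mul {u v : AddMonoidAlgebra ℝ G} (hu : IsNonneg u) (hv : IsNonneg v) :
    IsNonneg (u * v) :=
  fun a => by
    rw [coeff_mul_eq_sum]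
    exact Finset.sum_nonneg fun r _ => mul_nonneg (hu _) (hv _)

theorem IsNonneg.adj {u : AddMonoidAlgebra ℝ G} (hu : IsNonneg u) : IsNonneg (adj u) :=
  fun a => hu (-a)

theorem IsNonneg.expect {f : ι → AddMonoidAlgebra ℝ G} (hf : ∀ i, IsNonneg (f i)) :
    IsNonneg (𝔼 i, f i) :=
  fun a => by
    rw [coeff_expect]
    exact expect_nonneg' fun i => hf i a

theorem IsNonneg.coeff_le_mass {u : AddMonoidAlgebra ℝ G} (hu : IsNonneg u) (a : G) :
    u.coeff a ≤ mass u :=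
  Finset.single_le_sum (f := fun a => u.coeff a) (fun b _ => hu b) (Finset.mem_univ a)

theorem IsNonneg.mass_nonneg {u : AddMonoidAlgebra ℝ G} (hu : IsNonneg u) : 0 ≤ mass u :=
  Finset.sum_nonneg fun a _ => hu a

theorem IsNonneg.coeff_add_coeff_le {u : AddMonoidAlgebra ℝ G} (hu : IsNonneg u) {a b : G}
    (hab : a ≠ b) :
    u.coeff a + u.coeff b ≤ mass u := by
  classical
  rw [← Finset.sum_pair (f := fun a => u.coeff a) hab]
  exact Finset.sum_le_sum_of_subset_of_nonneg (Finset.subset_univ _) fun c _ _ => hu c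

theorem IsNonneg.exists_innerSum_le {u : AddMonoidAlgebra ℝ G} (hu : IsNonneg u) :
    ∃ g, innerSum u u ≤ mass u * u.coeff g := by
  obtain ⟨g, hg⟩ := Finite.exists_max fun a => u.coeff a
  refine ⟨g, ?_⟩
  rw [innerSum, mass, Finset.sum_mul]
  exact Finset.sum_le_sum fun a _ => mul_le_mul_of_nonneg_left (hg a) (hu a)

theorem mul_adj_mem_simplex {u v : AddMonoidAlgebra ℝ G} (hu : u ∈ simplex G) (hv : v ∈ simplex G) :
    u * adj v ∈ simplex G :=
  ⟨IsNonneg.mul hu.1 (IsNonneg.adj hv.1), by rw [mass_mul, mass_adj, hu.2, hv.2, one_mul]⟩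

theorem delta_mem_simplex (g : G) : delta g ∈ simplex G :=
  ⟨fun a => by classical rw [coeff_delta]; split_ifs <;> norm_num, mass_delta g⟩

theorem coeff_le_one {u : AddMonoidAlgebra ℝ G} (hu : u ∈ simplex G) (a : G) : u.coeff a ≤ 1 :=
  hu.2 ▸ IsNonneg.coeff_le_mass hu.1 a

/-- The triangle inequality for the probability that a difference takes a given value. -/
theorem coeff_mul_adj_triangle {P Q R : AddMonoidAlgebra ℝ G} (hP : P ∈ simplex G)
    (hQ : Q ∈ simplex G)
    (hR : R ∈ simplex G) (a b : G) :
    (P * adj R).coeff a + (R * adj Q).coeff b ≤ 1 + (P * adj Q).coeff (a + b) := by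
  have h1 : (P * adj Q).coeff (a + b) = ∑ r, P.coeff (a + r) * Q.coeff (r - b) := by
    rw [coeff_mul_adj, ← Equiv.sum_comp (Equiv.subRight b)]
    refine Finset.sum_congr rfl fun r _ => ?_
    simp only [Equiv.subRight_apply]
    congr 2
    abel
  have h2 : (R * adj Q).coeff b = ∑ r, R.coeff r * Q.coeff (r - b) := by
    rw [coeff_mul_adj, ← Equiv.sum_comp (Equiv.subRight b)]
    refine Finset.sum_congr rfl fun r _ => ?_
    simp only [Equiv.subRight_apply]
    congr 2
    abel
  have h3 : ∑ r, R.coeff r = 1 := hR.2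
  rw [h1, h2, coeff_mul_adj, ← h3, ← Finset.sum_add_distrib, ← Finset.sum_add_distrib]
  refine Finset.sum_le_sum fun r _ => ?_
  have := coeff_le_one hP (a + r)
  have := coeff_le_one hQ (r - b)
  have := coeff_le_one hR r
  have := hP.1 (a + r)
  have := hQ.1 (r - b)
  have := hR.1 r
  -- For numbers P, Q, R in [0, 1], PR + RQ ≤ R + PQ is the sum of R(1 - P)(1 - Q) ≥ 0 and (1 - R)PQ
  -- ≥ 0.
  have h4 : 0 ≤ R.coeff r * ((1 - P.coeff (a + r)) * (1 - Q.coeff (r - b))) := by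
    apply mul_nonneg _ (mul_nonneg _ _) <;> linarith
  have h5 : 0 ≤ (1 - R.coeff r) * (P.coeff (a + r) * Q.coeff (r - b)) := by
    apply mul_nonneg _ (mul_nonneg _ _) <;> linarith
  linarith

theorem coeff_mul_adj_neg (P Q : AddMonoidAlgebra ℝ G) (a : G) :
    (P * adj Q).coeff (-a) = (Q * adj P).coeff a := by
  rw [← coeff_adj, adj_mul, adj_adj, mul_comm]

/-- A family of probability measures on a finite group whose typical differences depend only on the
difference of the indices is governed by a homomorphism. -/
theorem exists_addHom_of_expect_lt {V : Type*} [AddCommGroup V] [Fintype V]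
    (f : V → AddMonoidAlgebra ℝ G)
    (hf : ∀ v, f v ∈ simplex G) (g : V → G)
    (hε : 𝔼 x, 𝔼 y, (1 - (f x * adj (f y)).coeff (g (y - x))) < 1 / 6) :
    ∃ θ : V →+ G, 𝔼 x, 𝔼 y, (1 - (f x * adj (f y)).coeff (θ (y - x))) ≤
      𝔼 x, 𝔼 y, (1 - (f x * adj (f y)).coeff (g (y - x))) := by
  set e : V → V → ℝ := fun x y => 1 - (f x * adj (f y)).coeff (g (y - x)) with he
  set ε := 𝔼 x, 𝔼 y, e x y with hεdef
  -- `D w a` measures how badly a serves as the difference at displacement w. It is subadditive in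
  -- (w, a), and two distinct values at the same w have costs summing to at least 1, so a value of
  -- cost below 1/3 is unique.
  set D : V → G → ℝ := fun w a => 𝔼 x, (1 - (f x * adj (f (x + w))).coeff a) with hD
  have hDadd : ∀ w₁ w₂ a₁ a₂, D (w₁ + w₂) (a₁ + a₂) ≤ D w₁ a₁ + D w₂ a₂ := by
    intro w₁ w₂ a₁ a₂
    have : D w₂ a₂ = 𝔼 x, (1 - (f (x + w₁) * adj (f (x + w₁ + w₂))).coeff a₂) :=
      (expect_add_right (fun x => 1 - (f x * adj (f (x + w₂))).coeff a₂) w₁).symm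
    rw [this]
    simp only [hD]
    rw [← Finset.expect_add_distrib]
    refine expect_mono fun x => ?_
    have := coeff_mul_adj_triangle (hf x) (hf (x + w₁ + w₂)) (hf (x + w₁)) a₁ a₂
    rw [← add_assoc]
    linarith
  have hDne : ∀ w a b, a ≠ b → 1 ≤ D w a + D w b := by
    intro w a b hab
    simp only [hD]
    rw [← Finset.expect_add_distrib]
    refine (Fintype.expect_one (ι := V) (M := ℝ)).symm.trans_le ?_
    refine expect_mono fun x => ?_
    have hm := mul_adj_mem_simplex (hf x) (hf (x + w))
    have := IsNonneg.coeff_add_coeff_le hm.1 hab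
    rw [hm.2] at this
    linarith
  have hDg : ∀ t : V → G, 𝔼 x, 𝔼 y, (1 - (f x * adj (f y)).coeff (t (y - x))) =
      𝔼 w, D w (t w) := by
    intro t
    simp only [hD]
    rw [expect_comm' (fun w x => 1 - (f x * adj (f (x + w))).coeff (t w))]
    refine Finset.expect_congr rfl fun x _ => ?_
    rw [← expect_add_left _ x]
    simp
  -- Compare x and x + w through a random third point x + u. The candidate g u - g (u - w) has
  -- average cost at most 2ε < 1/3, and this holds for every w.
  have hDsmall : ∀ w, ∃ a, D w a < 1 / 3 := by
    intro w
    obtain ⟨u, hu⟩ := exists_le_expect fun u : V => D w (g u - g (u - w))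
    refine ⟨_, hu.trans_lt ?_⟩
    have hle : 𝔼 u, D w (g u - g (u - w)) ≤ ε + ε := by
      have h1 : ε = 𝔼 u, 𝔼 x, e x (x + u) := by
        rw [expect_comm']
        exact Finset.expect_congr rfl fun x _ => (expect_add_left _ x).symm
      have h2 : ε = 𝔼 u, 𝔼 x, e (x + w) (x + u) := by
        rw [expect_comm', hεdef, ← expect_add_right _ w]
        exact Finset.expect_congr rfl fun x _ => (expect_add_left _ x).symm
      nth_rewrite 1 [h1]
      rw [h2, ← Finset.expect_add_distrib]
      refine expect_mono fun u => ?_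
      simp only [hD]
      rw [← Finset.expect_add_distrib]
      refine expect_mono fun x => ?_
      have := coeff_mul_adj_triangle (hf x) (hf (x + w)) (hf (x + u)) (g u) (-g (u - w))
      rw [coeff_mul_adj_neg, ← sub_eq_add_neg] at this
      have h4 : x + u - (x + w) = u - w := by abel
      simp only [he, add_sub_cancel_left, h4]
      linarith
    linarith
  choose t ht using fun w => Finite.exists_min (D w)
  have htsmall : ∀ w, D w (t w) < 1 / 3 := fun w => by
    obtain ⟨a, ha⟩ := hDsmall w
    exact (ht w a).trans_lt ha
  -- Otherwise two distinct values at w₁ + w₂ would have costs below 1/3 and below 2/3.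
  have hadd : ∀ w₁ w₂, t (w₁ + w₂) = t w₁ + t w₂ := by
    intro w₁ w₂
    by_contra hne
    have := hDne (w₁ + w₂) _ _ hne
    have := hDadd w₁ w₂ (t w₁) (t w₂)
    have := htsmall w₁
    have := htsmall w₂
    have := htsmall (w₁ + w₂)
    linarith
  refine ⟨AddMonoidHom.mk' t hadd, ?_⟩
  simp only [hεdef, he]
  rw [hDg g]
  exact (hDg t).trans_le (expect_mono fun w => ht w _)

end GroupAlgebraLemmas

/-! ### Kernels, surjectivity on subspaces and gluing of linear maps. -/

section LinearAlgebra

open Module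

variable {p : ℕ} [Fact p.Prime] {G K : Type*} [AddCommGroup G] [Module (ZMod p) G] [Fintype G]
  [AddCommGroup K] [Module (ZMod p) K] [Fintype K]

theorem prob_exists_le {ι κ : Type*} [Fintype ι] [Fintype κ] (Q : κ → ι → Prop) :
    prob (fun x => ∃ u, Q u x) ≤ ∑ u, prob (Q u) := by
  simp only [prob]
  rw [← Finset.expect_sum_comm]
  refine expect_mono fun x => ?_
  by_cases h : ∃ u, Q u x
  · obtain ⟨u, hu⟩ := h
    rw [if_pos ⟨u, hu⟩]
    have := Finset.single_le_sum (f := fun u => open Classical in if Q u x then (1 : ℝ) else 0)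
      (fun v _ => by split_ifs <;> norm_num) (Finset.mem_univ u)
    simpa [hu] using this
  · rw [if_neg h]
    exact Finset.sum_nonneg fun v _ => by split_ifs <;> norm_num

/-- The annihilator of W has dimension at most c, so pulling it back along b adds at most c to the
dimension of the kernel. -/
theorem finrank_comap_dualAnnihilator_le (b : G →ₗ[ZMod p] Dual (ZMod p) G)
    (W : Submodule (ZMod p) G) {c : ℕ} (hc : finrank (ZMod p) G ≤ finrank (ZMod p) W + c) :
    finrank (ZMod p) (W.dualAnnihilator.comap b) ≤ finrank (ZMod p) (LinearMap.ker b) + c := by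
  set Z := W.dualAnnihilator.comap b
  have h1 := LinearMap.finrank_range_add_finrank_ker (b.domRestrict Z)
  have h2 : finrank (ZMod p) (LinearMap.range (b.domRestrict Z)) ≤
      finrank (ZMod p) W.dualAnnihilator := by
    refine Submodule.finrank_mono ?_
    rintro _ ⟨⟨x, hx⟩, rfl⟩
    exact hx
  have h3 : finrank (ZMod p) (LinearMap.ker (b.domRestrict Z)) ≤
      finrank (ZMod p) (LinearMap.ker b) := by
    let f : LinearMap.ker (b.domRestrict Z) →ₗ[ZMod p] LinearMap.ker b :=
      (Z.subtype.comp (LinearMap.ker (b.domRestrict Z)).subtype).codRestrict _ fun x => x.2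
    refine LinearMap.finrank_le_finrank_of_injective (f := f) fun x y hxy => ?_
    exact Subtype.ext (Subtype.ext (congrArg (fun t : LinearMap.ker b => (t : G)) hxy))
  have h4 := Subspace.finrank_add_finrank_dualAnnihilator_eq W
  omega

/-- Row rank equals column rank: the flip is the dual map after the evaluation isomorphism. This
lets one rank hypothesis serve both for rows and for columns. -/
theorem finrank_ker_flip (b : G →ₗ[ZMod p] G →ₗ[ZMod p] ZMod p) :
    finrank (ZMod p) (LinearMap.ker b.flip) = finrank (ZMod p) (LinearMap.ker b) := by
  have h1 := LinearMap.finrank_range_add_finrank_ker b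
  have h2 := LinearMap.finrank_range_add_finrank_ker b.flip
  have h3 : b.flip = (LinearMap.dualMap b).comp (Dual.eval (ZMod p) G) := by
    ext x y
    rfl
  have h4 : finrank (ZMod p) (LinearMap.range b.flip) = finrank (ZMod p) (LinearMap.range b) := by
    rw [h3, LinearMap.range_comp_of_range_eq_top (f := Dual.eval (ZMod p) G) _
      (LinearMap.range_eq_top.2 (Module.evalEquiv (ZMod p) G).surjective)]
    exact LinearMap.finrank_range_dualMap_eq_finrank_range b
  omega

/-- If the forms `u ∘ γ` have small kernels then `γ x + C` maps a subspace of small codimension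
onto `K` for most `x`. -/
theorem prob_map_ne_top_le (γ : G →ₗ[ZMod p] G →ₗ[ZMod p] K) (C : G →ₗ[ZMod p] K) {τ : ℝ}
    (hτ0 : 0 ≤ τ) (hτ : ∀ u : Dual (ZMod p) K, u ≠ 0 →
      (p : ℝ) ^ finrank (ZMod p) (LinearMap.ker (γ.compr₂ u)) ≤ τ * Fintype.card G)
    (W : Submodule (ZMod p) G) {c : ℕ} (hc : finrank (ZMod p) G ≤ finrank (ZMod p) W + c) :
    prob (fun x => W.map (γ x + C) ≠ ⊤) ≤ p ^ finrank (ZMod p) K * (p ^ c * τ) := by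
  have : Finite (Dual (ZMod p) K) := Module.finite_of_finite (ZMod p)
  have := Fintype.ofFinite (Dual (ZMod p) K)
  have hp : (0 : ℝ) < p := by exact_mod_cast (Fact.out : p.Prime).pos
  have hG : (0 : ℝ) < Fintype.card G := by exact_mod_cast Fintype.card_pos
  -- A proper image lies in the kernel of some nonzero functional u; take a union bound over u. For
  -- fixed u any two bad x differ by an element of the pullback of the annihilator of W, so the bad
  -- x lie in a single coset of a small subspace.
  calc prob (fun x => W.map (γ x + C) ≠ ⊤)
      ≤ prob (fun x => ∃ u : Dual (ZMod p) K, u ≠ 0 ∧ ∀ w ∈ W, u (γ x w + C w) = 0) := by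
        refine prob_mono fun x hx => ?_
        obtain ⟨u, hu, hle⟩ := Submodule.exists_le_ker_of_lt_top _ (lt_top_iff_ne_top.2 hx)
        exact ⟨u, hu, fun w hw => hle ⟨w, hw, rfl⟩⟩
    _ ≤ ∑ u : Dual (ZMod p) K, prob (fun x => u ≠ 0 ∧ ∀ w ∈ W, u (γ x w + C w) = 0) :=
        prob_exists_le _
    _ ≤ ∑ _u : Dual (ZMod p) K, (p ^ c * τ) := by
        refine Finset.sum_le_sum fun u _ => ?_
        by_cases hex : ∃ x₀, u ≠ 0 ∧ ∀ w ∈ W, u (γ x₀ w + C w) = 0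
        · obtain ⟨x₀, hu, hx₀⟩ := hex
          set b : G →ₗ[ZMod p] Dual (ZMod p) G := γ.compr₂ u with hb
          have hcard : (Nat.card {x // u ≠ 0 ∧ ∀ w ∈ W, u (γ x w + C w) = 0} : ℝ) ≤
              Nat.card (W.dualAnnihilator.comap b) := by
            have : ∀ x : {x // u ≠ 0 ∧ ∀ w ∈ W, u (γ x w + C w) = 0},
                x.1 - x₀ ∈ W.dualAnnihilator.comap b := by
              rintro ⟨x, -, hx⟩
              rw [Submodule.mem_comap, Submodule.mem_dualAnnihilator]
              intro w hw
              have h1 := hx w hw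
              have h2 := hx₀ w hw
              rw [map_add] at h1 h2
              simp only [hb, map_sub, LinearMap.sub_apply, LinearMap.compr₂_apply]
              linear_combination h1 - h2
            have hinj : Function.Injective fun x : {x // u ≠ 0 ∧ ∀ w ∈ W, u (γ x w + C w) = 0} =>
                (⟨x.1 - x₀, this x⟩ : W.dualAnnihilator.comap b) := fun x y hxy =>
              Subtype.ext (sub_left_injective (b := x₀) (Subtype.ext_iff.1 hxy))
            exact_mod_cast Nat.card_le_card_of_injective _ hinj
          rw [prob_eq_card, div_le_iff₀ hG]
          refine hcard.trans ?_
          rw [Module.natCard_eq_pow_finrank (K := ZMod p), Nat.card_zmod, Nat.cast_pow]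
          calc (p : ℝ) ^ finrank (ZMod p) (W.dualAnnihilator.comap b)
              ≤ p ^ (finrank (ZMod p) (LinearMap.ker b) + c) :=
                pow_le_pow_right₀ (by exact_mod_cast (Fact.out : p.Prime).one_le)
                  (finrank_comap_dualAnnihilator_le b W hc)
            _ ≤ _ := by
                rw [pow_add]
                have := mul_le_mul_of_nonneg_right (hτ u hu) (pow_nonneg hp.le c)
                linarith
        · push Not at hex
          have : prob (fun x => u ≠ 0 ∧ ∀ w ∈ W, u (γ x w + C w) = 0) = 0 := by
            rw [prob]
            refine Finset.expect_eq_zero fun x _ => if_neg fun h => ?_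
            obtain ⟨w, hw, hne⟩ := hex x h.1
            exact hne (h.2 w hw)
          rw [this]
          positivity
    _ = p ^ finrank (ZMod p) K * (p ^ c * τ) := by
        rw [Finset.sum_const, nsmul_eq_mul, Finset.card_univ, ← Nat.card_eq_fintype_card,
          Module.natCard_eq_pow_finrank (K := ZMod p), Nat.card_zmod, Subspace.dual_finrank_eq,
          Nat.cast_pow]

theorem finrank_le_inf_ker {W : Submodule (ZMod p) G} (L : G →ₗ[ZMod p] K) {c : ℕ}
    (hc : finrank (ZMod p) G ≤ finrank (ZMod p) W + c) :
    finrank (ZMod p) G ≤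
      finrank (ZMod p) ↥(W ⊓ LinearMap.ker L) + (c + finrank (ZMod p) K) := by
  have h1 := Submodule.finrank_sup_add_finrank_inf_eq W (LinearMap.ker L)
  have h2 := LinearMap.finrank_range_add_finrank_ker L
  have h3 := Submodule.finrank_le (LinearMap.range L)
  have h4 := Submodule.finrank_le (W ⊔ LinearMap.ker L)
  omega

/-- Partial linear maps compatible on U₁ ∩ U₂ glue to U₁ + U₂, and a linear map on a subspace
extends to the whole space. -/
theorem exists_linearMap_eqOn_of_eqOn_inf (U₁ U₂ : Submodule (ZMod p) G)
    (A₁ A₂ : G →ₗ[ZMod p] G) (h : ∀ w ∈ U₁, w ∈ U₂ → A₁ w = A₂ w) :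
    ∃ A : G →ₗ[ZMod p] G, (∀ w ∈ U₁, A w = A₁ w) ∧ ∀ w ∈ U₂, A w = A₂ w := by
  let f₁ : G →ₗ.[ZMod p] G := ⟨U₁, A₁.domRestrict U₁⟩
  let f₂ : G →ₗ.[ZMod p] G := ⟨U₂, A₂.domRestrict U₂⟩
  have H : ∀ (x : f₁.domain) (y : f₂.domain), (x : G) = y → f₁ x = f₂ y := by
    rintro ⟨x, hx⟩ ⟨y, hy⟩ hxy
    dsimp only at hxy
    subst hxy
    exact h x hx hy
  obtain ⟨A, hA⟩ := LinearMap.exists_extend (f₁.sup f₂ H).toFun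
  have hA' : ∀ w (hw : w ∈ U₁ ⊔ U₂), A w = f₁.sup f₂ H ⟨w, hw⟩ := fun w hw =>
    LinearMap.congr_fun hA ⟨w, hw⟩
  refine ⟨A, fun w hw => ?_, fun w hw => ?_⟩
  · rw [hA' w (Submodule.mem_sup_left hw)]
    exact ((LinearPMap.left_le_sup f₁ f₂ H).2 (x := ⟨w, hw⟩) rfl).symm
  · rw [hA' w (Submodule.mem_sup_right hw)]
    exact ((LinearPMap.right_le_sup f₁ f₂ H).2 (x := ⟨w, hw⟩) rfl).symm

/-- This is the form in which general position is used: if L is onto already on W, then W + ker L is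
the whole space. -/
theorem exists_sub_mem_ker_of_map_eq_top {W : Submodule (ZMod p) G} {L : G →ₗ[ZMod p] K}
    (hL : W.map L = ⊤) (w : G) : ∃ v ∈ W, L (w - v) = 0 := by
  obtain ⟨v, hv, hvw⟩ := (hL ▸ Submodule.mem_top : L w ∈ W.map L)
  exact ⟨v, hv, by rw [map_sub, hvw, sub_self]⟩

end LinearAlgebra

/-! ### Correcting a mostly additive family of partial linear maps. -/

section Extension

open Module

variable {p : ℕ} [Fact p.Prime] {G K : Type*} [AddCommGroup G] [Module (ZMod p) G] [Fintype G]
  [AddCommGroup K] [Module (ZMod p) K] [Fintype K]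

/-- The linear map `M h` maps each subspace of codimension at most `7 * dim K` onto `K`, apart from
a proportion `σ` of all `h`. -/
def MostlyOnto (M : G → G →ₗ[ZMod p] K) (σ : ℝ) : Prop :=
  ∀ W : Submodule (ZMod p) G, finrank (ZMod p) G ≤ finrank (ZMod p) W + 7 * finrank (ZMod p) K →
    prob (fun h => W.map (M h) ≠ ⊤) ≤ σ

/-- The linear maps `T a`, each restricted to the kernel of `M a`, are additive in `a` at
`(a, b)`. -/
def AddAt (M : G →ₗ[ZMod p] G →ₗ[ZMod p] K) (T : G → G →ₗ[ZMod p] G) (a b : G) : Prop :=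
  ∀ w, M a w = 0 → M b w = 0 → T a w + T b w = T (a + b) w

variable {M : G →ₗ[ZMod p] G →ₗ[ZMod p] K} {T : G → G →ₗ[ZMod p] G} {σ ρ : ℝ}

/-- The map `A` agrees with `T a + T (h - a)` on the intersection of the kernels of `M h`
and `M a`. -/
def ExtendsAt (M : G →ₗ[ZMod p] G →ₗ[ZMod p] K) (T : G → G →ₗ[ZMod p] G) (h : G)
    (A : G →ₗ[ZMod p] G) (a : G) : Prop :=
  ∀ w, M h w = 0 → M a w = 0 → A w = T a w + T (h - a) w

/-- The maps `T a + T (h - a)` and `T b + T (h - b)` agree on the common kernel. -/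
def ConsistentAt (M : G →ₗ[ZMod p] G →ₗ[ZMod p] K) (T : G → G →ₗ[ZMod p] G) (h a b : G) : Prop :=
  ∀ w, M h w = 0 → M a w = 0 → M b w = 0 → T a w + T (h - a) w = T b w + T (h - b) w

/-- Both sides equal T (a - b) + T b + T (h - a). -/
theorem ConsistentAt.of_addAt {h a b : G} (h₁ : AddAt M T (a - b) b)
    (h₂ : AddAt M T (a - b) (h - a)) : ConsistentAt M T h a b := by
  intro w hw ha hb
  have e₁ := h₁ w (by simp [ha, hb]) hb
  have e₂ := h₂ w (by simp [ha, hb]) (by simp [hw, ha])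
  rw [sub_add_cancel] at e₁
  rw [show a - b + (h - a) = h - b by abel] at e₂
  rw [← e₁, ← e₂]
  abel

/-- For each fixed h the pairs (a - b, b) and (a - b, h - a) are uniform on G × G. The bound
therefore holds for every h, not only for most h. -/
theorem expect_prob_not_consistentAt_le
    (hT : prob (fun z : G × G => ¬ AddAt M T z.1 z.2) ≤ ρ) (h : G) :
    𝔼 a, prob (fun b => ¬ ConsistentAt M T h a b) ≤ 2 * ρ := by
  let e₁ : G × G ≃ G × G :=
    { toFun := fun z => (z.1 - z.2, z.2)
      invFun := fun z => (z.1 + z.2, z.2)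
      left_inv := fun z => by simp
      right_inv := fun z => by simp }
  let e₂ : G × G ≃ G × G :=
    { toFun := fun z => (z.1 - z.2, h - z.1)
      invFun := fun z => (h - z.2, h - z.2 - z.1)
      left_inv := fun z => by simp
      right_inv := fun z => by simp }
  have h₁ := prob_equiv e₁ fun z => ¬ AddAt M T z.1 z.2
  have h₂ := prob_equiv e₂ fun z => ¬ AddAt M T z.1 z.2
  rw [← prob_prod]
  calc prob (fun z : G × G => ¬ ConsistentAt M T h z.1 z.2)
      ≤ prob (fun z : G × G => ¬ AddAt M T (e₁ z).1 (e₁ z).2 ∨ ¬ AddAt M T (e₂ z).1 (e₂ z).2) := by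
        refine prob_mono fun z hz => ?_
        by_contra! hcon
        exact hz (.of_addAt hcon.1 hcon.2)
    _ ≤ ρ + ρ := (prob_or_le _ _).trans (add_le_add (h₁.trans_le hT) (h₂.trans_le hT))
    _ = 2 * ρ := by ring

theorem exists_extendsAt (hM : MostlyOnto (fun h => M h) σ)
    (hT : prob (fun z : G × G => ¬ AddAt M T z.1 z.2) ≤ ρ) (hρ : ρ ≤ 61 / 1000)
    (hσ : σ ≤ 1 / 10000) (h : G) :
    ∃ A : G →ₗ[ZMod p] G, prob (fun a => ¬ ExtendsAt M T h A a) ≤ 27 / 100 := by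
  have hE := expect_prob_not_consistentAt_le hT h
  obtain ⟨a, ha⟩ := exists_le_expect fun a => prob fun b => ¬ ConsistentAt M T h a b
  replace ha := ha.trans hE
  let V : G → Submodule (ZMod p) G := fun x => LinearMap.ker (M x)
  have hgen : 𝔼 b, prob (fun c => (V h ⊓ V c ⊓ V a).map (M b) ≠ ⊤) ≤ σ := by
    simp only [prob]
    rw [expect_comm']
    refine expect_le_const fun c => hM _ ?_
    have h0 : finrank (ZMod p) G ≤ finrank (ZMod p) (⊤ : Submodule (ZMod p) G) + 0 := by simp
    have h1 := finrank_le_inf_ker (M a) (finrank_le_inf_ker (M c) (finrank_le_inf_ker (M h) h0))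
    rw [top_inf_eq] at h1
    exact h1.trans (by simp only [V]; omega)
  have hcons : 1 - 2 * ρ ≤ prob (ConsistentAt M T h a) := by
    have := prob_not (ConsistentAt M T h a)
    linarith
  obtain ⟨b, hab, hb⟩ := exists_le_div_of_prob
    (f := fun b => prob (fun c => ¬ ConsistentAt M T h b c) +
      prob (fun c => (V h ⊓ V c ⊓ V a).map (M b) ≠ ⊤)) (a := 2 * ρ + σ) (b := 1 - 2 * ρ)
    (P := ConsistentAt M T h a) (fun b => add_nonneg (prob_nonneg _) (prob_nonneg _))
    (by rw [Finset.expect_add_distrib]; exact add_le_add hE hgen) (by linarith) hcons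
  -- Consistency of a and b is exactly compatibility on the overlap, so the two candidates glue.
  obtain ⟨A, hA₁, hA₂⟩ := exists_linearMap_eqOn_of_eqOn_inf (V h ⊓ V a) (V h ⊓ V b)
    (T a + T (h - a)) (T b + T (h - b)) fun w hw₁ hw₂ => hab w hw₁.1 hw₁.2 hw₂.2
  -- Split w in V h ∩ V c as v + (w - v) with v in V a and w - v in V b; consistency of c with a
  -- handles the first term and consistency with b the second.
  have key : ∀ c, ConsistentAt M T h a c → ConsistentAt M T h b c →
      (V h ⊓ V c ⊓ V a).map (M b) = ⊤ → ExtendsAt M T h A c := by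
    intro c hac hbc htop w hhw hcw
    obtain ⟨v, ⟨⟨hvh, hvc⟩, hva⟩, hv⟩ := exists_sub_mem_ker_of_map_eq_top htop w
    simp only [V, SetLike.mem_coe, LinearMap.mem_ker] at hvh hvc hva
    have hd : M h (w - v) = 0 := by rw [map_sub, hhw, hvh, sub_self]
    have hdc : M c (w - v) = 0 := by rw [map_sub, hcw, hvc, sub_self]
    have e₁ := hA₁ v ⟨hvh, hva⟩
    have e₂ := hA₂ (w - v) ⟨hd, hv⟩
    have e₃ := hac v hvh hva hvc
    have e₄ := hbc (w - v) hd hv hdc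
    rw [LinearMap.add_apply] at e₁ e₂
    have e₅ : A w = A v + A (w - v) := by rw [← map_add, add_sub_cancel]
    rw [e₅, e₁, e₂, e₃, e₄]
    simp only [map_sub]
    abel
  refine ⟨A, ?_⟩
  have hle : prob (fun c => ¬ ExtendsAt M T h A c) ≤
      prob (fun c => ¬ ConsistentAt M T h a c) + (prob (fun c => ¬ ConsistentAt M T h b c) +
        prob (fun c => (V h ⊓ V c ⊓ V a).map (M b) ≠ ⊤)) := by
    refine le_trans (prob_mono fun c hc => ?_) ((prob_or_le _ _).trans
      (add_le_add le_rfl (prob_or_le _ _)))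
    by_contra! hcon
    exact hc (key c hcon.1 hcon.2.1 hcon.2.2)
  have hdiv : (2 * ρ + σ) / (1 - 2 * ρ) ≤ 14 / 100 := by
    rw [div_le_iff₀ (by linarith)]
    linarith
  linarith

/-- A good pair (a, b) yields additivity at (h, h') on V h ∩ V h' ∩ V a ∩ V b. Two good pairs in
general position give two such subspaces that together span V h ∩ V h'. -/
theorem addAt_of_extendsAt (hM : MostlyOnto (fun h => M h) σ)
    (hT : prob (fun z : G × G => ¬ AddAt M T z.1 z.2) ≤ ρ) (hρ : ρ ≤ 61 / 1000)
    (hσ : σ ≤ 1 / 10000) {A : G → G →ₗ[ZMod p] G}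
    (hA : ∀ h, prob (fun a => ¬ ExtendsAt M T h (A h) a) ≤ 27 / 100) (h h' : G) :
    AddAt M A h h' := by
  let V : G → Submodule (ZMod p) G := fun x => LinearMap.ker (M x)
  let Q : G × G → Prop := fun z => ExtendsAt M T h (A h) z.1 ∧ ExtendsAt M T h' (A h') z.2 ∧
    ExtendsAt M T (h + h') (A (h + h')) (z.1 + z.2) ∧ AddAt M T z.1 z.2 ∧
    AddAt M T (h - z.1) (h' - z.2)
  -- Three extension failures and two additivity failures: 3 · 0.27 + 2 · 0.061 = 0.932 < 1.
  have hQ : prob (fun z => ¬ Q z) ≤ 932 / 1000 := by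
    have h1 : prob (fun z : G × G => ¬ ExtendsAt M T h (A h) z.1) ≤ 27 / 100 := by
      rw [prob_prod (κ := G) fun a _ => ¬ ExtendsAt M T h (A h) a]
      simp only [prob]
      rw [expect_comm']
      exact expect_le_const fun _ => hA h
    have h2 : prob (fun z : G × G => ¬ ExtendsAt M T h' (A h') z.2) ≤ 27 / 100 := by
      rw [prob_prod (ι := G) fun _ b => ¬ ExtendsAt M T h' (A h') b]
      exact expect_le_const fun _ => hA h'
    have h3 : prob (fun z : G × G => ¬ ExtendsAt M T (h + h') (A (h + h')) (z.1 + z.2)) ≤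
        27 / 100 := by
      rw [prob_prod fun a b => ¬ ExtendsAt M T (h + h') (A (h + h')) (a + b)]
      refine expect_le_const fun a => ?_
      exact (prob_equiv (Equiv.addLeft a) fun b =>
        ¬ ExtendsAt M T (h + h') (A (h + h')) b).trans_le (hA (h + h'))
    have h4 : prob (fun z : G × G => ¬ AddAt M T (h - z.1) (h' - z.2)) ≤ ρ :=
      (prob_equiv ((Equiv.subLeft h).prodCongr (Equiv.subLeft h'))
        fun z => ¬ AddAt M T z.1 z.2).trans_le hT
    have : prob (fun z => ¬ Q z) ≤ 27 / 100 + (27 / 100 + (27 / 100 + (ρ + ρ))) := by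
      refine le_trans (prob_mono fun z hz => ?_) ((prob_or_le _ _).trans (add_le_add h1
        ((prob_or_le _ _).trans (add_le_add h2 ((prob_or_le _ _).trans (add_le_add h3
          ((prob_or_le _ _).trans (add_le_add hT h4))))))))
      by_contra! hcon
      exact hz hcon
    linarith
  have hQ' : 68 / 1000 ≤ prob Q := by
    have := prob_not Q
    linarith
  obtain ⟨⟨a₀, b₀⟩, hz₀⟩ := exists_of_prob_pos (P := Q) (by linarith)
  let W := V h ⊓ V h' ⊓ V a₀ ⊓ V b₀
  have hW : finrank (ZMod p) G ≤ finrank (ZMod p) W + 4 * finrank (ZMod p) K := by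
    have h0 : finrank (ZMod p) G ≤ finrank (ZMod p) (⊤ : Submodule (ZMod p) G) + 0 := by simp
    have h1 := finrank_le_inf_ker (M b₀) (finrank_le_inf_ker (M a₀)
      (finrank_le_inf_ker (M h') (finrank_le_inf_ker (M h) h0)))
    rw [top_inf_eq] at h1
    exact h1.trans (by simp only [W, V]; omega)
  have hgen₁ : prob (fun z : G × G => W.map (M z.1) ≠ ⊤) ≤ σ := by
    rw [prob_prod (κ := G) fun a _ => W.map (M a) ≠ ⊤]
    simp only [prob]
    rw [expect_comm']
    exact expect_le_const fun _ => hM W (by omega)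
  have hgen₂ : prob (fun z : G × G => (W ⊓ V z.1).map (M z.2) ≠ ⊤) ≤ σ := by
    rw [prob_prod fun a b => (W ⊓ V a).map (M b) ≠ ⊤]
    refine expect_le_const fun a => hM _ ?_
    exact (finrank_le_inf_ker (M a) hW).trans (by simp only [V]; omega)
  have hex : 0 < prob fun z => Q z ∧ W.map (M z.1) = ⊤ ∧ (W ⊓ V z.1).map (M z.2) = ⊤ := by
    have h1 : prob (fun z => ¬ (Q z ∧ W.map (M z.1) = ⊤ ∧ (W ⊓ V z.1).map (M z.2) = ⊤)) ≤
        932 / 1000 + (σ + σ) := by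
      refine le_trans (prob_mono fun z hz => ?_) ((prob_or_le _ _).trans (add_le_add hQ
        ((prob_or_le _ _).trans (add_le_add hgen₁ hgen₂))))
      by_contra! hcon
      exact hz hcon
    have h2 := prob_not fun z => Q z ∧ W.map (M z.1) = ⊤ ∧ (W ⊓ V z.1).map (M z.2) = ⊤
    linarith
  obtain ⟨⟨a, b⟩, hz, htop₁, htop₂⟩ := exists_of_prob_pos hex
  have key : ∀ a b, Q (a, b) → ∀ w, M h w = 0 → M h' w = 0 → M a w = 0 → M b w = 0 →
      A h w + A h' w = A (h + h') w := by
    rintro a b ⟨q₁, q₂, q₃, q₄, q₅⟩ w hw hw' ha hb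
    dsimp only at q₁ q₂ q₃ q₄ q₅
    rw [q₁ w hw ha, q₂ w hw' hb, q₃ w (by simp [hw, hw']) (by simp [ha, hb]), ← q₄ w ha hb,
      show h + h' - (a + b) = h - a + (h' - b) by abel,
      ← q₅ w (by simp [hw, ha]) (by simp [hw', hb])]
    abel
  intro w hw hw'
  obtain ⟨v, hvW, hv⟩ := exists_sub_mem_ker_of_map_eq_top htop₁ w
  obtain ⟨v', ⟨hvW', hva'⟩, hv'⟩ := exists_sub_mem_ker_of_map_eq_top htop₂ (w - v)
  have hva'' : M a v' = 0 := hva'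
  have hsum : v + v' ∈ W := W.add_mem hvW hvW'
  obtain ⟨⟨⟨s₁, s₂⟩, s₃⟩, s₄⟩ := hsum
  simp only [V, SetLike.mem_coe, LinearMap.mem_ker] at s₁ s₂ s₃ s₄
  have e₁ := key a₀ b₀ hz₀ (v + v') s₁ s₂ s₃ s₄
  have e₂ := key a b hz (w - (v + v')) (by rw [map_sub, hw, s₁, sub_self])
    (by rw [map_sub, hw', s₂, sub_self]) (by rw [← sub_sub, map_sub, hv, hva'', sub_self])
    (by rw [← sub_sub]; exact hv')
  have e₃ : ∀ B : G →ₗ[ZMod p] G, B w = B (v + v') + B (w - (v + v')) := fun B => by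
    rw [← map_add, add_sub_cancel]
  rw [e₃ (A h), e₃ (A h'), e₃ (A (h + h')), ← e₁, ← e₂]
  abel

/-- More than σ good indices include two, a₀ and a, in general position, and then V h is the sum of
V h ∩ V a₀ and V h ∩ V a. -/
theorem eqOn_ker_of_extendsAt (hM : MostlyOnto (fun h => M h) σ) {h : G} {A B : G →ₗ[ZMod p] G}
    (hAB : σ < prob fun a => ∀ w, M h w = 0 → M a w = 0 → A w = B w) (hσ : 0 ≤ σ) (w : G)
    (hw : M h w = 0) : A w = B w := by
  let V : G → Submodule (ZMod p) G := fun x => LinearMap.ker (M x)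
  let Q : G → Prop := fun a => ∀ w, M h w = 0 → M a w = 0 → A w = B w
  obtain ⟨a₀, ha₀⟩ := exists_of_prob_pos (hσ.trans_lt hAB)
  have hgen : prob (fun a => (V h ⊓ V a₀).map (M a) ≠ ⊤) ≤ σ := by
    refine hM _ ?_
    have h0 : finrank (ZMod p) G ≤ finrank (ZMod p) (⊤ : Submodule (ZMod p) G) + 0 := by simp
    have h1 := finrank_le_inf_ker (M a₀) (finrank_le_inf_ker (M h) h0)
    rw [top_inf_eq] at h1
    exact h1.trans (by simp only [V]; omega)
  obtain ⟨a, ha, htop⟩ : ∃ a, Q a ∧ (V h ⊓ V a₀).map (M a) = ⊤ := by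
    by_contra! hcon
    exact hAB.not_ge ((prob_mono hcon).trans hgen)
  obtain ⟨v, ⟨hv₁, hv₂⟩, hv⟩ := exists_sub_mem_ker_of_map_eq_top htop w
  have hv₁' : M h v = 0 := hv₁
  have e₁ := ha₀ v hv₁ hv₂
  have e₂ := ha (w - v) (by rw [map_sub, hw, hv₁', sub_self]) hv
  rw [map_sub, map_sub, e₁] at e₂
  exact sub_left_injective e₂

/-- A family of linear maps, additive on the common kernels for most pairs of indices, agrees for
most indices with a family that is additive for all pairs. -/
theorem exists_addAt_of_prob (hM : MostlyOnto (fun h => M h) σ)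
    (hT : prob (fun z : G × G => ¬ AddAt M T z.1 z.2) ≤ ρ) (hρ : ρ ≤ 61 / 1000)
    (hσ : σ ≤ 1 / 10000) (hσ0 : 0 ≤ σ) :
    ∃ A : G → G →ₗ[ZMod p] G, (∀ h h', AddAt M A h h') ∧
      7 / 10 * prob (fun h => ¬ ∀ w, M h w = 0 → A h w = T h w) ≤ ρ := by
  choose A hA using exists_extendsAt hM hT hρ hσ
  refine ⟨A, addAt_of_extendsAt hM hT hρ hσ hA, ?_⟩
  have hρ' : 𝔼 h, prob (fun a => ¬ AddAt M T a (h - a)) ≤ ρ := by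
    refine le_trans (le_of_eq ?_) hT
    rw [prob_prod fun a b => ¬ AddAt M T a b]
    simp only [prob]
    rw [expect_comm']
    refine Finset.expect_congr rfl fun a _ => ?_
    exact Fintype.expect_equiv (Equiv.subRight a) _ _ fun _ => rfl
  -- If T were additive at (a, h - a) for more than 3/10 of all a, then more than 3/10 - 27/100 > σ
  -- of them would make A h and T h agree on V h ∩ V a, hence on V h. So each disagreement has cost
  -- at least 7/10.
  refine le_trans (mul_prob_le_expect (fun h => prob_nonneg _) fun h hh => ?_) hρ'
  by_contra! hlt
  refine hh fun w hw => ?_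
  refine eqOn_ker_of_extendsAt hM (h := h) ?_ hσ0 w hw
  have h1 : prob (fun a => ¬ ∀ w, M h w = 0 → M a w = 0 → A h w = T h w) ≤
      27 / 100 + prob (fun a => ¬ AddAt M T a (h - a)) := by
    refine le_trans (prob_mono fun a ha => ?_) ((prob_or_le _ _).trans (add_le_add (hA h) le_rfl))
    by_contra! hcon
    refine ha fun w hw haw => ?_
    rw [hcon.1 w hw haw, hcon.2 w haw (by simp [hw, haw]), add_sub_cancel]
  have h2 := prob_not fun a => ∀ w, M h w = 0 → M a w = 0 → A h w = T h w
  linarith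

end Extension

/-! ### Indicators and exact fibre densities. -/

section Density

open Module

open Classical in
/-- The indicator of a proposition. -/
def ind (P : Prop) : ℝ := if P then 1 else 0

theorem ind_pos {P : Prop} (h : P) : ind P = 1 := if_pos h

theorem ind_neg {P : Prop} (h : ¬ P) : ind P = 0 := if_neg h

theorem ind_nonneg (P : Prop) : 0 ≤ ind P := by
  by_cases h : P <;> simp [ind, h]

theorem ind_le_one (P : Prop) : ind P ≤ 1 := by
  by_cases h : P <;> simp [ind, h]

theorem ind_mono {P Q : Prop} (h : P → Q) : ind P ≤ ind Q := by
  by_cases hP : P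
  · rw [ind_pos hP, ind_pos (h hP)]
  · rw [ind_neg hP]
    exact ind_nonneg Q

theorem ind_or_le (P Q : Prop) : ind (P ∨ Q) ≤ ind P + ind Q := by
  by_cases hP : P <;> by_cases hQ : Q <;> simp [ind, hP, hQ]

theorem ind_and (P Q : Prop) : ind (P ∧ Q) = ind P * ind Q := by
  by_cases hP : P <;> by_cases hQ : Q <;> simp [ind, hP, hQ]

theorem prob_eq_expect_ind {ι : Type*} [Fintype ι] (P : ι → Prop) :
    prob P = 𝔼 x, ind (P x) := rfl

/-- The density of a fibre of a linear map onto `K`. -/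
def dens (K : Type*) [Fintype K] : ℝ := (Fintype.card K : ℝ)⁻¹

theorem dens_pos (K : Type*) [Fintype K] [Nonempty K] : 0 < dens K :=
  inv_pos.2 (by exact_mod_cast Fintype.card_pos)

theorem dens_le_one (K : Type*) [Fintype K] [Nonempty K] : dens K ≤ 1 :=
  inv_le_one_of_one_le₀ (by exact_mod_cast Fintype.card_pos)

theorem dens_prod (K : Type*) [Fintype K] : dens (K × K) = dens K ^ 2 := by
  simp [dens, Fintype.card_prod, pow_two]

variable {p : ℕ} [Fact p.Prime] {G K : Type*} [AddCommGroup G] [Module (ZMod p) G] [Fintype G]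
  [AddCommGroup K] [Module (ZMod p) K] [Fintype K]

theorem prob_eq_dens (L : G →ₗ[ZMod p] K) (hL : Function.Surjective L) (c : K) :
    prob (fun x => L x = c) = dens K := by
  have h0 : ∀ c, prob (fun x => L x = c) = prob fun x => L x = 0 := by
    intro c
    obtain ⟨x₀, rfl⟩ := hL c
    rw [← prob_equiv (Equiv.addRight x₀) fun x => L x = L x₀]
    simp
  have h1 : ∑ c, prob (fun x => L x = c) = 1 := by
    simp only [prob]
    rw [← Finset.expect_sum_comm]
    refine (Finset.expect_congr rfl fun x _ => ?_).trans (Fintype.expect_one (ι := G))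
    rw [Finset.sum_eq_single (L x) (fun c _ hc => if_neg hc.symm)
      fun h => absurd (Finset.mem_univ _) h, if_pos rfl]
  have hK : (Fintype.card K : ℝ) ≠ 0 := by exact_mod_cast Fintype.card_ne_zero
  rw [Finset.sum_congr rfl fun c _ => h0 c, Finset.sum_const, nsmul_eq_mul, Finset.card_univ] at h1
  rw [h0, dens, eq_inv_of_mul_eq_one_right h1]

theorem prob_eq_zero_le (L : G →ₗ[ZMod p] K) :
    prob (fun x => L x = 0) ≤ dens K + ind ((⊤ : Submodule (ZMod p) G).map L ≠ ⊤) := by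
  by_cases h : (⊤ : Submodule (ZMod p) G).map L = ⊤
  · rw [Submodule.map_top, LinearMap.range_eq_top] at h
    rw [prob_eq_dens L h]
    linarith [ind_nonneg ((⊤ : Submodule (ZMod p) G).map L ≠ ⊤)]
  · rw [ind_pos h]
    linarith [dens_pos K, prob_le_one fun x => L x = 0]

theorem surjective_of_map_top {L : G →ₗ[ZMod p] K}
    (h : (⊤ : Submodule (ZMod p) G).map L = ⊤) : Function.Surjective L := by
  rwa [Submodule.map_top, LinearMap.range_eq_top] at h

theorem surjective_prod {L₁ L₂ : G →ₗ[ZMod p] K} (h₁ : (⊤ : Submodule (ZMod p) G).map L₁ = ⊤)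
    (h₂ : (LinearMap.ker L₁).map L₂ = ⊤) : Function.Surjective (L₁.prod L₂) := by
  rintro ⟨a, b⟩
  obtain ⟨x, rfl⟩ := surjective_of_map_top h₁ a
  obtain ⟨y, hy, hyb⟩ : b - L₂ x ∈ (LinearMap.ker L₁).map L₂ := h₂ ▸ Submodule.mem_top
  have hy' : L₁ y = 0 := hy
  exact ⟨x + y, by simp [hy', hyb]⟩

/-- The pair of linear maps `L x`, `L x'` is jointly onto, in a form suited to induction. -/
def JointlyOnto (L₁ L₂ : G →ₗ[ZMod p] K) : Prop :=
  (⊤ : Submodule (ZMod p) G).map L₁ = ⊤ ∧ (LinearMap.ker L₁).map L₂ = ⊤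

theorem prob_pair_eq {L₁ L₂ : G →ₗ[ZMod p] K} (h : JointlyOnto L₁ L₂) (a b : K) :
    prob (fun x => L₁ x = a ∧ L₂ x = b) = dens K ^ 2 := by
  rw [← dens_prod, ← prob_eq_dens (L₁.prod L₂) (surjective_prod h.1 h.2) (a, b)]
  simp [Prod.ext_iff]

theorem MostlyOnto.prob_top {L : G → G →ₗ[ZMod p] K} {σ : ℝ} (hL : MostlyOnto L σ) :
    prob (fun x => (⊤ : Submodule (ZMod p) G).map (L x) ≠ ⊤) ≤ σ :=
  hL ⊤ (by simp)

theorem MostlyOnto.expect_not_jointlyOnto {L : G → G →ₗ[ZMod p] K} {σ : ℝ}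
    (hL : MostlyOnto L σ) : 𝔼 x, 𝔼 x', ind (¬ JointlyOnto (L x) (L x')) ≤ 2 * σ := by
  have h1 : 𝔼 x, 𝔼 x' : G, ind ((⊤ : Submodule (ZMod p) G).map (L x) ≠ ⊤) ≤ σ := by
    simp only [Fintype.expect_const]
    exact hL.prob_top
  have h2 : 𝔼 x, 𝔼 x', ind ((LinearMap.ker (L x)).map (L x') ≠ ⊤) ≤ σ := by
    refine expect_le_const fun x => hL _ ?_
    have h0 : finrank (ZMod p) G ≤ finrank (ZMod p) (⊤ : Submodule (ZMod p) G) + 0 := by simp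
    have h1 := finrank_le_inf_ker (L x) h0
    rw [top_inf_eq] at h1
    omega
  calc 𝔼 x, 𝔼 x', ind (¬ JointlyOnto (L x) (L x'))
      ≤ 𝔼 x, 𝔼 x', (ind ((⊤ : Submodule (ZMod p) G).map (L x) ≠ ⊤) +
          ind ((LinearMap.ker (L x)).map (L x') ≠ ⊤)) := by
        refine expect_mono fun x => expect_mono fun x' => (ind_mono fun h => ?_).trans
          (ind_or_le _ _)
        by_contra! hcon
        exact h hcon
    _ ≤ 2 * σ := by
        simp only [Finset.expect_add_distrib]
        linarith

/-- The average over a subspace as a weighted average over the whole space. -/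
theorem expect_ker_add (L : G →ₗ[ZMod p] K) (hL : Function.Surjective L)
    [Fintype (LinearMap.ker L)] (F : G → ℝ) (x₀ : G) :
    dens K * 𝔼 v : LinearMap.ker L, F (x₀ + v) = 𝔼 x, ind (L x = L x₀) * F x := by
  classical
  have hcard : dens K = (Fintype.card (LinearMap.ker L) : ℝ) / Fintype.card G := by
    rw [← prob_eq_dens L hL 0, prob_eq_card, ← Nat.card_eq_fintype_card (α := LinearMap.ker L)]
    rfl
  have hker : (Fintype.card (LinearMap.ker L) : ℝ) ≠ 0 := by exact_mod_cast Fintype.card_ne_zero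
  rw [← expect_add_left _ x₀, Fintype.expect_eq_sum_div_card, Fintype.expect_eq_sum_div_card, hcard]
  have hsum : ∑ v : LinearMap.ker L, F (x₀ + v) =
      ∑ x, ind (L (x₀ + x) = L x₀) * F (x₀ + x) := by
    have h1 : ∀ x, ind (L (x₀ + x) = L x₀) * F (x₀ + x) =
        if x ∈ LinearMap.ker L then F (x₀ + x) else 0 := by
      intro x
      by_cases hx : L x = 0 <;> simp [ind, hx]
    rw [Finset.sum_congr rfl fun x _ => h1 x, ← Finset.sum_filter]
    exact (Finset.sum_subtype (Finset.univ.filter fun x => x ∈ LinearMap.ker L)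
      (fun x => Finset.mem_filter_univ x) fun x => F (x₀ + x)).symm
  rw [hsum]
  field_simp

end Density

/-! ### Column averages, the mass of the mixed convolution and its concentration. -/

section Columns

open Module

variable {p : ℕ} [Fact p.Prime] {G K : Type*} [AddCommGroup G] [Module (ZMod p) G] [Fintype G]
  [AddCommGroup K] [Module (ZMod p) K] [Fintype K]

/-- The function `φ` takes values in the simplex on `{(x, y) : L x y = d x}` and is zero
elsewhere. -/
structure SimplexOn (L : G → G →ₗ[ZMod p] K) (d : G → K)
    (φ : G → G → AddMonoidAlgebra ℝ G) : Prop where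
  mem : ∀ x y, L x y = d x → φ x y ∈ simplex G
  zero : ∀ x y, L x y ≠ d x → φ x y = 0

/-- The density of the column `{y : L x y = d x}`. -/
def colDens (L : G → G →ₗ[ZMod p] K) (d : G → K) (x : G) : ℝ := prob fun y => L x y = d x

/-- The average of `φ(x, y) φ(x, y + h)*` over `y`. -/
def col (φ : G → G → AddMonoidAlgebra ℝ G) (h x : G) : AddMonoidAlgebra ℝ G :=
  𝔼 y, φ x y * adj (φ x (y + h))

/-- The mass of `col φ h x * (col φ h x')*` outside `a`. -/
def defect (φ : G → G → AddMonoidAlgebra ℝ G) (h x x' a : G) : ℝ :=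
  mass (col φ h x * adj (col φ h x')) - (col φ h x * adj (col φ h x')).coeff a

theorem mixedConv_eq (φ : G → G → AddMonoidAlgebra ℝ G) (w h : G) :
    mixedConv φ w h = 𝔼 x, col φ h x * adj (col φ h (x + w)) := by
  have hv : ∀ x, vertConv φ φ x h = adj (col φ h x) := by
    intro x
    rw [vertConv, col, adj_expect]
    refine Fintype.expect_equiv (Equiv.subRight h) _ _ fun y => ?_
    rw [adj_mul, adj_adj, Equiv.subRight_apply, sub_add_cancel, mul_comm]
  rw [mixedConv, horizConv]
  refine Fintype.expect_equiv (Equiv.subRight w) _ _ fun x => ?_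
  rw [hv, hv, adj_adj, Equiv.subRight_apply, sub_add_cancel, mul_comm]

theorem mass_sub_coeff_mixedConv (φ : G → G → AddMonoidAlgebra ℝ G) (w h a : G) :
    mass (mixedConv φ w h) - (mixedConv φ w h).coeff a = 𝔼 x, defect φ h x (x + w) a := by
  simp only [mixedConv_eq, mass_expect, coeff_expect, defect, Finset.expect_sub_distrib]

theorem expect_atPar (φ : G → G → AddMonoidAlgebra ℝ G) (w h x : G) :
    𝔼 y₁, 𝔼 y₂, atPar φ w h x y₁ y₂ = col φ h x * adj (col φ h (x + w)) := by
  simp only [col, adj_expect, Finset.expect_mul_expect, atPar, adj_mul, adj_adj, mul_assoc]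

variable {L : G → G →ₗ[ZMod p] K} {d : G → K} {φ : G → G → AddMonoidAlgebra ℝ G}

theorem SimplexOn.isNonneg (hφ : SimplexOn L d φ) (x y : G) : IsNonneg (φ x y) := by
  by_cases h : L x y = d x
  · exact (hφ.mem x y h).1
  · rw [hφ.zero x y h]
    exact .zero

theorem SimplexOn.mass_eq (hφ : SimplexOn L d φ) (x y : G) : mass (φ x y) = ind (L x y = d x) := by
  by_cases h : L x y = d x
  · rw [ind_pos h, (hφ.mem x y h).2]
  · rw [ind_neg h, hφ.zero x y h, mass_zero]

theorem SimplexOn.isNonneg_col (hφ : SimplexOn L d φ) (h x : G) : IsNonneg (col φ h x) :=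
  .expect fun y => (hφ.isNonneg x y).mul (hφ.isNonneg x (y + h)).adj

theorem ind_mul_ind_add (x y h : G) :
    ind (L x y = d x) * ind (L x (y + h) = d x) = ind (L x h = 0) * ind (L x y = d x) := by
  by_cases h1 : L x y = d x
  · simp [h1, mul_comm]
  · simp [ind_neg h1]

theorem SimplexOn.mass_col (hφ : SimplexOn L d φ) (h x : G) :
    mass (col φ h x) = ind (L x h = 0) * colDens L d x := by
  rw [col, mass_expect, colDens, prob_eq_expect_ind, Finset.mul_expect]
  refine Finset.expect_congr rfl fun y _ => ?_
  rw [mass_mul, mass_adj, hφ.mass_eq, hφ.mass_eq, ind_mul_ind_add]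

theorem colDens_nonneg (x : G) : 0 ≤ colDens L d x := prob_nonneg _

theorem colDens_le_one (x : G) : colDens L d x ≤ 1 := prob_le_one _

/-- The points `x` for which `L x` is not onto. -/
def Degenerate (L : G → G →ₗ[ZMod p] K) (x : G) : Prop :=
  (⊤ : Submodule (ZMod p) G).map (L x) ≠ ⊤

theorem colDens_eq {x : G} (hx : ¬ Degenerate L x) : colDens L d x = dens K :=
  prob_eq_dens _ (surjective_of_map_top (not_not.1 hx)) _

theorem colDens_le (x : G) : colDens L d x ≤ dens K + ind (Degenerate L x) := by
  by_cases hx : Degenerate L x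
  · rw [ind_pos hx]
    linarith [dens_pos K, colDens_le_one (L := L) (d := d) x]
  · rw [ind_neg hx, colDens_eq hx, add_zero]

/-- The two quantities are equal unless a point is degenerate, and then the trivial bound 1
suffices. Error terms in σ enter in this way throughout. -/
theorem abs_colDens_mul_sub_le (x x' : G) :
    |colDens L d x * colDens L d x' - dens K ^ 2| ≤
      ind (Degenerate L x) + ind (Degenerate L x') := by
  have hq := dens_pos K
  have hq1 := dens_le_one K
  have h1 := colDens_nonneg (L := L) (d := d) x
  have h2 := colDens_nonneg (L := L) (d := d) x'
  have h3 := colDens_le_one (L := L) (d := d) x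
  have h4 := colDens_le_one (L := L) (d := d) x'
  have hbd : |colDens L d x * colDens L d x' - dens K ^ 2| ≤ 1 := by
    rw [abs_le]
    constructor <;> nlinarith [mul_nonneg h1 h2]
  have i1 := ind_nonneg (Degenerate L x)
  have i2 := ind_nonneg (Degenerate L x')
  by_cases hx : Degenerate L x
  · rw [ind_pos hx]
    linarith
  · by_cases hx' : Degenerate L x'
    · rw [ind_pos hx']
      linarith
    · rw [colDens_eq hx, colDens_eq hx', pow_two, sub_self, abs_zero]
      linarith

theorem SimplexOn.mass_col_mul (hφ : SimplexOn L d φ) (h x x' : G) :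
    mass (col φ h x * adj (col φ h x')) =
      ind (L x h = 0) * ind (L x' h = 0) * (colDens L d x * colDens L d x') := by
  rw [mass_mul, mass_adj, hφ.mass_col, hφ.mass_col]
  ring

theorem SimplexOn.isNonneg_col_mul (hφ : SimplexOn L d φ) (h x x' : G) :
    IsNonneg (col φ h x * adj (col φ h x')) :=
  (hφ.isNonneg_col h x).mul (hφ.isNonneg_col h x').adj

theorem SimplexOn.defect_nonneg (hφ : SimplexOn L d φ) (h x x' a : G) : 0 ≤ defect φ h x x' a :=
  sub_nonneg.2 ((hφ.isNonneg_col_mul h x x').coeff_le_mass a)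

theorem SimplexOn.defect_le_mass (hφ : SimplexOn L d φ) (h x x' a : G) :
    defect φ h x x' a ≤ mass (col φ h x * adj (col φ h x')) :=
  sub_le_self _ (hφ.isNonneg_col_mul h x x' a)

theorem SimplexOn.defect_le (hφ : SimplexOn L d φ) (h x x' a : G) :
    defect φ h x x' a ≤ ind (L x h = 0) * ind (L x' h = 0) := by
  refine (hφ.defect_le_mass h x x' a).trans ?_
  rw [hφ.mass_col_mul]
  exact mul_le_of_le_one_right (mul_nonneg (ind_nonneg _) (ind_nonneg _))
    (mul_le_one₀ (colDens_le_one x) (colDens_nonneg x') (colDens_le_one x'))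

theorem SimplexOn.defect_le_one (hφ : SimplexOn L d φ) (h x x' a : G) : defect φ h x x' a ≤ 1 :=
  (hφ.defect_le h x x' a).trans (mul_le_one₀ (ind_le_one _) (ind_nonneg _) (ind_le_one _))

/-- The weight is redundant because φ vanishes wherever μ does. -/
theorem SimplexOn.weightPar_smul_atPar (hφ : SimplexOn L d φ) {μ : G → G → ℝ}
    (hμ : ∀ x y, μ x y = ind (L x y = d x)) (w h x y₁ y₂ : G) :
    weightPar μ w h x y₁ y₂ • atPar φ w h x y₁ y₂ = atPar φ w h x y₁ y₂ := by
  have hz : ∀ x y, μ x y = 1 ∨ φ x y = 0 := fun x y => by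
    by_cases h : L x y = d x
    · left; rw [hμ, ind_pos h]
    · right; exact hφ.zero x y h
  rw [weightPar]
  rcases hz x y₁ with h1 | h1
  · rcases hz x (y₁ + h) with h2 | h2
    · rcases hz (x + w) y₂ with h3 | h3
      · rcases hz (x + w) (y₂ + h) with h4 | h4
        · rw [h1, h2, h3, h4]; simp
        · simp [atPar, h4]
      · simp [atPar, h3, adj_zero]
    · simp [atPar, h2, adj_zero]
  · simp [atPar, h1]

theorem SimplexOn.weightPar_eq_mass (hφ : SimplexOn L d φ) {μ : G → G → ℝ}
    (hμ : ∀ x y, μ x y = ind (L x y = d x)) (w h x y₁ y₂ : G) :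
    weightPar μ w h x y₁ y₂ = mass (atPar φ w h x y₁ y₂) := by
  simp only [weightPar, atPar, mass_mul, mass_adj, hφ.mass_eq, hμ]

theorem SimplexOn.isApproxBihom_iff (hφ : SimplexOn L d φ) {μ : G → G → ℝ} {η : ℝ}
    (hμ : ∀ x y, μ x y = ind (L x y = d x)) :
    IsApproxBihom η μ φ ↔ (1 - η) * (𝔼 w, 𝔼 h, mass (mixedConv φ w h) ^ 2) ≤
      𝔼 w, 𝔼 h, innerSum (mixedConv φ w h) (mixedConv φ w h) := by
  have h1 : ∀ w h, 𝔼 x, 𝔼 y₁, 𝔼 y₂, weightPar μ w h x y₁ y₂ • atPar φ w h x y₁ y₂ =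
      mixedConv φ w h := fun w h => by
    simp only [hφ.weightPar_smul_atPar hμ, expect_atPar, mixedConv_eq]
  have h2 : ∀ w h, 𝔼 x, 𝔼 y₁, 𝔼 y₂, weightPar μ w h x y₁ y₂ = mass (mixedConv φ w h) :=
    fun w h => by
      simp only [hφ.weightPar_eq_mass hμ, ← mass_expect, expect_atPar, mixedConv_eq]
  simp only [IsApproxBihom, h1, h2]

variable {M : G →ₗ[ZMod p] G →ₗ[ZMod p] K} {σ η : ℝ}

theorem SimplexOn.isNonneg_mixedConv (hφ : SimplexOn L d φ) (w h : G) :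
    IsNonneg (mixedConv φ w h) := by
  rw [mixedConv_eq]
  exact .expect fun x => hφ.isNonneg_col_mul h x (x + w)

theorem SimplexOn.mass_mixedConv (hφ : SimplexOn L d φ)
    (hLM : ∀ x w h, L (x + w) h = L x h + M h w) (w h : G) :
    mass (mixedConv φ w h) = ind (M h w = 0) *
      𝔼 x, ind (L x h = 0) * (colDens L d x * colDens L d (x + w)) := by
  rw [mixedConv_eq, mass_expect, Finset.mul_expect]
  refine Finset.expect_congr rfl fun x _ => ?_
  rw [hφ.mass_col_mul, hLM]
  by_cases h1 : L x h = 0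
  · simp only [h1, zero_add]
    ring
  · simp [ind_neg h1]

theorem SimplexOn.mass_mixedConv_le_one (hφ : SimplexOn L d φ) (w h : G) :
    mass (mixedConv φ w h) ≤ 1 := by
  rw [mixedConv_eq, mass_expect]
  refine expect_le_const fun x => ?_
  rw [hφ.mass_col_mul]
  exact mul_le_one₀ (mul_le_one₀ (ind_le_one _) (ind_nonneg _) (ind_le_one _))
    (mul_nonneg (colDens_nonneg _) (colDens_nonneg _))
    (mul_le_one₀ (colDens_le_one _) (colDens_nonneg _) (colDens_le_one _))

theorem prob_apply_eq_zero (hLM : ∀ x w h, L (x + w) h = L x h + M h w) {h : G}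
    (hh : ¬ Degenerate (fun h => M h) h) : prob (fun x => L x h = 0) = dens K := by
  rw [← prob_eq_dens (M h) (surjective_of_map_top (not_not.1 hh)) (-L 0 h)]
  congr 1
  ext x
  have := hLM 0 x h
  rw [zero_add] at this
  rw [this, add_comm, add_eq_zero_iff_eq_neg]

theorem abs_prob_apply_sub_le (hLM : ∀ x w h, L (x + w) h = L x h + M h w) (h : G) :
    |prob (fun x => L x h = 0) - dens K| ≤ ind (Degenerate (fun h => M h) h) := by
  by_cases hh : Degenerate (fun h => M h) h
  · rw [ind_pos hh, abs_le]
    have := dens_pos K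
    have := dens_le_one K
    have := prob_nonneg fun x => L x h = 0
    have := prob_le_one fun x => L x h = 0
    constructor <;> linarith
  · rw [ind_neg hh, prob_apply_eq_zero hLM hh, sub_self, abs_zero]

theorem abs_expect_le {ι : Type*} [Fintype ι] (f : ι → ℝ) : |𝔼 i, f i| ≤ 𝔼 i, |f i| := by
  rw [abs_le, ← Finset.expect_neg_distrib]
  exact ⟨expect_mono fun i => neg_abs_le _, expect_mono fun i => le_abs_self _⟩

/-- When M h w = 0 the condition L x h = 0 contributes a factor q and each of the two columns
another; every deviation is charged to a degenerate index. -/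
theorem SimplexOn.abs_mass_mixedConv_sub_le (hφ : SimplexOn L d φ)
    (hLM : ∀ x w h, L (x + w) h = L x h + M h w) (w h : G) :
    |mass (mixedConv φ w h) - ind (M h w = 0) * dens K ^ 3| ≤
      (𝔼 x, (ind (Degenerate L x) + ind (Degenerate L (x + w)))) +
        ind (Degenerate (fun h => M h) h) := by
  have hq := dens_pos K
  have hq1 := dens_le_one K
  have e1 : mass (mixedConv φ w h) - ind (M h w = 0) * dens K ^ 3 = ind (M h w = 0) *
      ((𝔼 x, ind (L x h = 0) * (colDens L d x * colDens L d (x + w) - dens K ^ 2)) +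
        dens K ^ 2 * (prob (fun x => L x h = 0) - dens K)) := by
    rw [hφ.mass_mixedConv hLM]
    simp only [mul_sub, Finset.expect_sub_distrib]
    rw [← Finset.expect_mul, ← prob_eq_expect_ind]
    ring
  rw [e1, abs_mul, abs_of_nonneg (ind_nonneg _)]
  refine (mul_le_of_le_one_left (abs_nonneg _) (ind_le_one _)).trans ((abs_add_le _ _).trans
    (add_le_add ((abs_expect_le _).trans (expect_mono fun x => ?_)) ?_))
  · rw [abs_mul, abs_of_nonneg (ind_nonneg _)]
    exact (mul_le_of_le_one_left (abs_nonneg _) (ind_le_one _)).trans (abs_colDens_mul_sub_le _ _)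
  · rw [abs_mul, abs_of_nonneg (by positivity)]
    exact (mul_le_of_le_one_left (abs_nonneg _) (pow_le_one₀ hq.le hq1)).trans
      (abs_prob_apply_sub_le hLM h)

theorem SimplexOn.expect_abs_mass_mixedConv_sub_le (hφ : SimplexOn L d φ)
    (hLM : ∀ x w h, L (x + w) h = L x h + M h w) (hL : MostlyOnto L σ)
    (hM : MostlyOnto (fun h => M h) σ) :
    𝔼 w, 𝔼 h, |mass (mixedConv φ w h) - ind (M h w = 0) * dens K ^ 3| ≤ 3 * σ := by
  refine (expect_mono fun w => expect_mono fun h =>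
    hφ.abs_mass_mixedConv_sub_le hLM w h).trans ?_
  have h1 : ∀ w, 𝔼 x, ind (Degenerate L (x + w)) ≤ σ := fun w =>
    (expect_add_right (fun x => ind (Degenerate L x)) w).trans_le hL.prob_top
  have h2 : 𝔼 x, ind (Degenerate L x) ≤ σ := hL.prob_top
  have h3 : 𝔼 h, ind (Degenerate (fun h => M h) h) ≤ σ := hM.prob_top
  refine expect_le_const fun w => ?_
  simp only [Finset.expect_add_distrib, Fintype.expect_const]
  linarith [h1 w]

/-- The values of the mixed convolution of an approximate bihomomorphism are concentrated at a
single point on average. -/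
theorem SimplexOn.exists_expect_defect_le (hφ : SimplexOn L d φ)
    (hLM : ∀ x w h, L (x + w) h = L x h + M h w) (hL : MostlyOnto L σ)
    (hM : MostlyOnto (fun h => M h) σ) (hη0 : 0 ≤ η) (hη : η ≤ 1)
    (h : (1 - η) * (𝔼 w, 𝔼 h, mass (mixedConv φ w h) ^ 2) ≤
      𝔼 w, 𝔼 h, innerSum (mixedConv φ w h) (mixedConv φ w h)) :
    ∃ g : G → G → G, dens K ^ 3 * 𝔼 h, 𝔼 x, 𝔼 x', defect φ h x x' (g h (x' - x)) ≤
      η * dens K ^ 7 + 10 * σ := by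
  have hq := dens_pos K
  have hq1 := dens_le_one K
  choose g hg using fun h w => (hφ.isNonneg_mixedConv w h).exists_innerSum_le
  refine ⟨g, ?_⟩
  have hσ := hφ.expect_abs_mass_mixedConv_sub_le hLM hL hM
  have hσ0 : 0 ≤ σ := (prob_nonneg _).trans hL.prob_top
  have e1 : 𝔼 h, 𝔼 x, 𝔼 x', defect φ h x x' (g h (x' - x)) =
      𝔼 w, 𝔼 h, (mass (mixedConv φ w h) - (mixedConv φ w h).coeff (g h w)) := by
    rw [expect_comm' fun w h => mass (mixedConv φ w h) - (mixedConv φ w h).coeff (g h w)]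
    refine Finset.expect_congr rfl fun h _ => ?_
    simp only [mass_sub_coeff_mixedConv]
    rw [expect_comm' fun w x => defect φ h x (x + w) (g h w)]
    refine Finset.expect_congr rfl fun x _ => ?_
    rw [← expect_add_left _ x]
    simp only [add_sub_cancel_left]
  -- With mass m, value t at the chosen point and squared norm s ≤ mt, one has m(m - t) ≤ m² - s.
  -- Replacing the factor m by q³ costs |m - q³| when M h w = 0; otherwise m itself is an error
  -- term.
  have e2 : dens K ^ 3 * 𝔼 h, 𝔼 x, 𝔼 x', defect φ h x x' (g h (x' - x)) ≤
      (𝔼 w, 𝔼 h, mass (mixedConv φ w h) ^ 2) -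
        (𝔼 w, 𝔼 h, innerSum (mixedConv φ w h) (mixedConv φ w h)) + 3 * σ := by
    refine le_trans ?_ (add_le_add le_rfl hσ)
    rw [e1, Finset.mul_expect]
    simp only [Finset.mul_expect]
    simp only [← Finset.expect_sub_distrib, ← Finset.expect_add_distrib]
    refine expect_mono fun w => expect_mono fun h => ?_
    have m0 := (hφ.isNonneg_mixedConv w h).mass_nonneg
    have m1 := hφ.mass_mixedConv_le_one w h
    have g0 := hφ.isNonneg_mixedConv w h (g h w)
    have g1 := (hφ.isNonneg_mixedConv w h).coeff_le_mass (g h w)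
    have hg' := hg h w
    generalize mass (mixedConv φ w h) = m at *
    generalize (mixedConv φ w h).coeff (g h w) = t at *
    generalize innerSum (mixedConv φ w h) (mixedConv φ w h) = s at *
    by_cases hw : M h w = 0
    · rw [ind_pos hw, one_mul]
      have k1 : (dens K ^ 3 - m) * (m - t) ≤ |m - dens K ^ 3| := by
        rw [abs_sub_comm]
        calc (dens K ^ 3 - m) * (m - t) ≤ |dens K ^ 3 - m| * (m - t) :=
              mul_le_mul_of_nonneg_right (le_abs_self _) (by linarith)
          _ ≤ _ := mul_le_of_le_one_right (abs_nonneg _) (by linarith)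
      linarith
    · rw [ind_neg hw, zero_mul, sub_zero, abs_of_nonneg m0]
      have k1 : dens K ^ 3 * (m - t) ≤ m - t :=
        mul_le_of_le_one_left (by linarith) (pow_le_one₀ hq.le hq1)
      have k2 : m * t ≤ m * m := mul_le_mul_of_nonneg_left g1 m0
      linarith
  -- The mass is about q³ on an event of probability about q.
  have e3 : 𝔼 w, 𝔼 h, mass (mixedConv φ w h) ^ 2 ≤ dens K ^ 7 + 7 * σ := by
    have hprob : 𝔼 w, 𝔼 h, ind (M h w = 0) ≤ dens K + σ := by
      rw [expect_comm']
      refine (expect_mono fun h => prob_eq_zero_le (M h)).trans ?_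
      rw [Finset.expect_add_distrib, Fintype.expect_const]
      linarith [hM.prob_top, prob_eq_expect_ind fun h : G =>
        (⊤ : Submodule (ZMod p) G).map (M h) ≠ ⊤]
    calc 𝔼 w, 𝔼 h, mass (mixedConv φ w h) ^ 2
        ≤ 𝔼 w, 𝔼 h, (dens K ^ 6 * ind (M h w = 0) +
            2 * |mass (mixedConv φ w h) - ind (M h w = 0) * dens K ^ 3|) := by
          refine expect_mono fun w => expect_mono fun h => ?_
          have m0 := (hφ.isNonneg_mixedConv w h).mass_nonneg
          have m1 := hφ.mass_mixedConv_le_one w h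
          generalize mass (mixedConv φ w h) = m at *
          have c0 : 0 ≤ ind (M h w = 0) * dens K ^ 3 :=
            mul_nonneg (ind_nonneg _) (by positivity)
          have c1 : ind (M h w = 0) * dens K ^ 3 ≤ 1 :=
            mul_le_one₀ (ind_le_one _) (by positivity) (pow_le_one₀ hq.le hq1)
          have c2 : (ind (M h w = 0) * dens K ^ 3) ^ 2 = dens K ^ 6 * ind (M h w = 0) := by
            by_cases hw : M h w = 0
            · rw [ind_pos hw]; ring
            · rw [ind_neg hw]; ring
          rw [← c2]
          generalize ind (M h w = 0) * dens K ^ 3 = c at *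
          have k1 : (m - c) * (m + c) ≤ |m - c| * 2 :=
            (mul_le_mul_of_nonneg_right (le_abs_self _) (by linarith)).trans
              (mul_le_mul_of_nonneg_left (by linarith) (abs_nonneg _))
          linarith
      _ = dens K ^ 6 * (𝔼 w, 𝔼 h, ind (M h w = 0)) +
            2 * 𝔼 w, 𝔼 h, |mass (mixedConv φ w h) - ind (M h w = 0) * dens K ^ 3| := by
          simp only [Finset.expect_add_distrib, Finset.mul_expect]
      _ ≤ dens K ^ 6 * (dens K + σ) + 2 * (3 * σ) :=
          add_le_add (mul_le_mul_of_nonneg_left hprob (by positivity)) (by linarith)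
      _ ≤ _ := by
          have : dens K ^ 6 * σ ≤ σ := mul_le_of_le_one_left hσ0 (pow_le_one₀ hq.le hq1)
          nlinarith
  have e4 := mul_le_mul_of_nonneg_left e3 hη0
  have e5 : η * σ ≤ σ := mul_le_of_le_one_left hσ0 hη
  linarith

end Columns

/-! ### Linear maps governing individual rows. -/

section Rows

open Module

variable {p : ℕ} [Fact p.Prime] {G K : Type*} [AddCommGroup G] [Module (ZMod p) G] [Fintype G]
  [AddCommGroup K] [Module (ZMod p) K] [Fintype K]

open Classical in
/-- The normalised column average, replaced by a point mass where `L x` is not onto. -/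
def fill (L : G → G →ₗ[ZMod p] K) (φ : G → G → AddMonoidAlgebra ℝ G) (h x : G) :
    AddMonoidAlgebra ℝ G :=
  if Degenerate L x then delta 0 else (dens K)⁻¹ • col φ h x

variable {L : G → G →ₗ[ZMod p] K} {d : G → K} {φ : G → G → AddMonoidAlgebra ℝ G}
  {M : G →ₗ[ZMod p] G →ₗ[ZMod p] K} {σ η : ℝ}

theorem SimplexOn.fill_mem (hφ : SimplexOn L d φ) {h x : G} (hx : L x h = 0) :
    fill L φ h x ∈ simplex G := by
  have hq := dens_pos K
  rw [fill]
  split_ifs with hd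
  · exact delta_mem_simplex 0
  · refine ⟨fun a => ?_, ?_⟩
    · exact mul_nonneg (inv_nonneg.2 hq.le) (hφ.isNonneg_col h x a)
    · rw [mass_smul, hφ.mass_col, ind_pos hx, colDens_eq hd, one_mul, inv_mul_cancel₀ hq.ne']

theorem SimplexOn.abs_defect_sub_le (hφ : SimplexOn L d φ) (h x x' a : G) :
    |defect φ h x x' a - dens K ^ 2 * (ind (L x h = 0) * (ind (L x' h = 0) *
        (1 - (fill L φ h x * adj (fill L φ h x')).coeff a)))| ≤
      ind (Degenerate L x) + ind (Degenerate L x') := by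
  have hq := dens_pos K
  have hq1 := dens_le_one K
  have i1 := ind_nonneg (Degenerate L x)
  have i2 := ind_nonneg (Degenerate L x')
  have d0 := hφ.defect_nonneg h x x' a
  have d1 := hφ.defect_le h x x' a
  by_cases hx : L x h = 0
  swap
  · rw [ind_neg hx, zero_mul] at d1
    rw [le_antisymm d1 d0, ind_neg hx]
    simp only [zero_mul, mul_zero, sub_zero, abs_zero]
    linarith
  by_cases hx' : L x' h = 0
  swap
  · rw [ind_neg hx', mul_zero] at d1
    rw [le_antisymm d1 d0, ind_neg hx']
    simp only [zero_mul, mul_zero, sub_zero, abs_zero]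
    linarith
  rw [ind_pos hx, ind_pos hx', one_mul] at d1
  rw [ind_pos hx, ind_pos hx', one_mul, one_mul]
  have hbd : |defect φ h x x' a - dens K ^ 2 *
      (1 - (fill L φ h x * adj (fill L φ h x')).coeff a)| ≤ 1 := by
    have hm := mul_adj_mem_simplex (hφ.fill_mem hx) (hφ.fill_mem hx')
    have f0 := hm.1 a
    have f1 := coeff_le_one hm a
    have hq2 : dens K ^ 2 ≤ 1 := pow_le_one₀ hq.le hq1
    have k1 : dens K ^ 2 * (1 - (fill L φ h x * adj (fill L φ h x')).coeff a) ≤ 1 :=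
      mul_le_one₀ hq2 (by linarith) (by linarith)
    have k2 : 0 ≤ dens K ^ 2 * (1 - (fill L φ h x * adj (fill L φ h x')).coeff a) :=
      mul_nonneg (by positivity) (by linarith)
    rw [abs_le]
    constructor <;> linarith
  by_cases hd : Degenerate L x
  · rw [ind_pos hd]
    linarith
  by_cases hd' : Degenerate L x'
  · rw [ind_pos hd']
    linarith
  have e : defect φ h x x' a = dens K ^ 2 *
      (1 - (fill L φ h x * adj (fill L φ h x')).coeff a) := by
    rw [fill, fill, if_neg hd, if_neg hd', defect, hφ.mass_col_mul, ind_pos hx, ind_pos hx',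
      colDens_eq hd, colDens_eq hd', adj_smul, smul_mul_smul_comm,
      AddMonoidAlgebra.coeff_smul_apply, smul_eq_mul]
    field_simp
  rw [e, sub_self, abs_zero]
  linarith

theorem SimplexOn.abs_expect_defect_sub_le (hφ : SimplexOn L d φ) (hL : MostlyOnto L σ) (h : G)
    (g : G → G) :
    |(𝔼 x, 𝔼 x', defect φ h x x' (g (x' - x))) - dens K ^ 2 * 𝔼 x, ind (L x h = 0) *
      𝔼 x', ind (L x' h = 0) * (1 - (fill L φ h x * adj (fill L φ h x')).coeff (g (x' - x)))| ≤
      2 * σ := by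
  have h1 : (𝔼 x, 𝔼 x', defect φ h x x' (g (x' - x))) - dens K ^ 2 * (𝔼 x, ind (L x h = 0) *
      𝔼 x', ind (L x' h = 0) * (1 - (fill L φ h x * adj (fill L φ h x')).coeff (g (x' - x)))) =
      𝔼 x, 𝔼 x', (defect φ h x x' (g (x' - x)) - dens K ^ 2 * (ind (L x h = 0) *
        (ind (L x' h = 0) *
          (1 - (fill L φ h x * adj (fill L φ h x')).coeff (g (x' - x)))))) := by
    simp only [Finset.expect_sub_distrib, Finset.mul_expect]
  rw [h1]
  have h2 : 𝔼 x, ind (Degenerate L x) ≤ σ := hL.prob_top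
  calc _ ≤ 𝔼 x, 𝔼 x', (ind (Degenerate L x) + ind (Degenerate L x')) :=
        (abs_expect_le _).trans (expect_mono fun x => (abs_expect_le _).trans
          (expect_mono fun x' => hφ.abs_defect_sub_le h x x' _))
    _ ≤ 2 * σ := by
        simp only [Finset.expect_add_distrib, Fintype.expect_const]
        linarith

/-- In a row where the values are sufficiently concentrated they are governed by a linear map. -/
theorem SimplexOn.exists_linearMap_expect_defect_le (hφ : SimplexOn L d φ)
    (hLM : ∀ x w h, L (x + w) h = L x h + M h w) (hL : MostlyOnto L σ) {h : G}
    (hh : ¬ Degenerate (fun h => M h) h) (g : G → G)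
    (hg : (𝔼 x, 𝔼 x', defect φ h x x' (g (x' - x))) + 2 * σ < dens K ^ 4 / 6) :
    ∃ T : G →ₗ[ZMod p] G, 𝔼 x, 𝔼 x', defect φ h x x' (T (x' - x)) ≤
      (𝔼 x, 𝔼 x', defect φ h x x' (g (x' - x))) + 4 * σ := by
  classical
  have hq := dens_pos K
  have hsurj : Function.Surjective (M h) := surjective_of_map_top (not_not.1 hh)
  -- The row {x : L x h = 0} is the coset x₀ + ker (M h), so the stability lemma applies on ker (M
  -- h). The two row constraints and the two column normalisations explain q⁴ in the threshold q⁴/6.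
  obtain ⟨x₀, hx₀⟩ := hsurj (-L 0 h)
  have hM : ∀ x, L x h = M h x - M h x₀ := fun x => by
    have := hLM 0 x h
    rw [zero_add] at this
    rw [this, hx₀]
    abel
  have hiff : ∀ x, ind (L x h = 0) = ind (M h x = M h x₀) := fun x => by
    rw [hM, sub_eq_zero]
  have hmem : ∀ v : LinearMap.ker (M h), L (x₀ + v) h = 0 := fun v => by
    have : M h (v : G) = 0 := v.2
    rw [hM, map_add, this, add_zero, sub_self]
  have key : ∀ t : G → G, 𝔼 x, ind (L x h = 0) * (𝔼 x', ind (L x' h = 0) *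
      (1 - (fill L φ h x * adj (fill L φ h x')).coeff (t (x' - x)))) =
      dens K ^ 2 * 𝔼 v : LinearMap.ker (M h), 𝔼 v' : LinearMap.ker (M h),
        (1 - (fill L φ h (x₀ + v) * adj (fill L φ h (x₀ + v'))).coeff (t (v' - v))) := by
    intro t
    simp only [hiff]
    rw [← expect_ker_add (M h) hsurj (fun x => 𝔼 x', ind (M h x' = M h x₀) *
      (1 - (fill L φ h x * adj (fill L φ h x')).coeff (t (x' - x)))), pow_two, mul_assoc]
    congr 1
    rw [Finset.mul_expect]
    refine Finset.expect_congr rfl fun v _ => ?_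
    rw [← expect_ker_add (M h) hsurj (fun x' =>
      (1 - (fill L φ h (x₀ + v) * adj (fill L φ h x')).coeff (t (x' - (x₀ + v)))))]
    simp only [add_sub_add_left_eq_sub]
  have hg' := abs_le.1 (hφ.abs_expect_defect_sub_le hL h g)
  rw [key g] at hg'
  obtain ⟨θ, hθ⟩ := exists_addHom_of_expect_lt
    (fun v : LinearMap.ker (M h) => fill L φ h (x₀ + v)) (fun v => hφ.fill_mem (hmem v))
    (fun v => g v) (by
      simp only [AddSubgroupClass.coe_sub]
      by_contra! hcon
      have : dens K ^ 4 * (1 / 6) ≤ dens K ^ 4 * _ :=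
        mul_le_mul_of_nonneg_left hcon (by positivity)
      linarith [hg'.1])
  obtain ⟨T, hT⟩ := LinearMap.exists_extend (θ.toZModLinearMap p)
  have hT' : ∀ v : LinearMap.ker (M h), T v = θ v := fun v => LinearMap.congr_fun hT v
  refine ⟨T, ?_⟩
  have ht := abs_le.1 (hφ.abs_expect_defect_sub_le hL h T)
  rw [key T] at ht
  simp only [← AddSubgroupClass.coe_sub, hT'] at ht
  simp only [← AddSubgroupClass.coe_sub] at hg'
  have hmul := mul_le_mul_of_nonneg_left (mul_le_mul_of_nonneg_left hθ (sq_nonneg (dens K)))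
    (sq_nonneg (dens K))
  linarith [ht.2, hg'.1]

/-- Outside a small set of rows, the values in a row are governed by a linear map. -/
theorem SimplexOn.exists_linearMap_family (hφ : SimplexOn L d φ)
    (hLM : ∀ x w h, L (x + w) h = L x h + M h w) (hL : MostlyOnto L σ)
    (hM : MostlyOnto (fun h => M h) σ) {g : G → G → G} {ε : ℝ}
    (hg : 𝔼 h, 𝔼 x, 𝔼 x', defect φ h x x' (g h (x' - x)) ≤ ε) :
    ∃ (H : G → Prop) (T : G → G →ₗ[ZMod p] G),
      dens K ^ 4 / 6 * prob (fun h => ¬ H h) ≤ ε + 3 * σ ∧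
      (∀ h, H h → ¬ Degenerate (fun h => M h) h) ∧
      𝔼 h, ind (H h) * (𝔼 x, 𝔼 x', defect φ h x x' (T h (x' - x))) ≤ ε + 4 * σ := by
  have hq := dens_pos K
  have hq1 := dens_le_one K
  have hσ0 : 0 ≤ σ := (prob_nonneg _).trans hL.prob_top
  set δ : G → ℝ := fun h => 𝔼 x, 𝔼 x', defect φ h x x' (g h (x' - x)) with hδ
  have hδ0 : ∀ h, 0 ≤ δ h := fun h => expect_nonneg' fun x => expect_nonneg' fun x' =>
    hφ.defect_nonneg _ _ _ _
  let H : G → Prop := fun h => ¬ Degenerate (fun h => M h) h ∧ δ h + 2 * σ < dens K ^ 4 / 6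
  have hT : ∀ h, ∃ T : G →ₗ[ZMod p] G, H h →
      𝔼 x, 𝔼 x', defect φ h x x' (T (x' - x)) ≤ δ h + 4 * σ := by
    intro h
    by_cases hH : H h
    · obtain ⟨T, hT⟩ := hφ.exists_linearMap_expect_defect_le hLM hL hH.1 (g h) hH.2
      exact ⟨T, fun _ => hT⟩
    · exact ⟨0, fun h => absurd h hH⟩
  choose T hT using hT
  refine ⟨H, T, ?_, fun h hh => hh.1, ?_⟩
  · have h1 : prob (fun h => ¬ H h) ≤ prob (Degenerate (fun h => M h)) +
        prob (fun h => dens K ^ 4 / 6 ≤ δ h + 2 * σ) := by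
      refine le_trans (prob_mono fun h hh => ?_) (prob_or_le _ _)
      by_contra! hcon
      exact hh hcon
    have h2 : dens K ^ 4 / 6 * prob (fun h => dens K ^ 4 / 6 ≤ δ h + 2 * σ) ≤ ε + 2 * σ := by
      refine (mul_prob_le_expect (f := fun h => δ h + 2 * σ)
        (fun h => by linarith [hδ0 h]) fun h hh => hh).trans ?_
      rw [Finset.expect_add_distrib, Fintype.expect_const]
      linarith
    have h3 : prob (Degenerate (fun h => M h)) ≤ σ := hM.prob_top
    have hq4 : dens K ^ 4 ≤ 1 := pow_le_one₀ hq.le hq1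
    have h4 := mul_le_mul_of_nonneg_left h1 (by positivity : 0 ≤ dens K ^ 4 / 6)
    have h5 : dens K ^ 4 / 6 * prob (Degenerate (fun h => M h)) ≤ 1 * σ :=
      mul_le_mul (by linarith) h3 (prob_nonneg _) zero_le_one
    linarith
  · calc 𝔼 h, ind (H h) * (𝔼 x, 𝔼 x', defect φ h x x' (T h (x' - x)))
        ≤ 𝔼 h, (δ h + 4 * σ) := by
          refine expect_mono fun h => ?_
          by_cases hH : H h
          · rw [ind_pos hH, one_mul]
            exact hT h hH
          · rw [ind_neg hH, zero_mul]
            linarith [hδ0 h]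
      _ ≤ ε + 4 * σ := by
          rw [Finset.expect_add_distrib, Fintype.expect_const]
          linarith

end Rows

/-! ### Stacked parallelograms and additivity between rows. -/

section Pairs

open Module

variable {p : ℕ} [Fact p.Prime] {G K : Type*} [AddCommGroup G] [Module (ZMod p) G] [Fintype G]
  [AddCommGroup K] [Module (ZMod p) K] [Fintype K]
  {L : G → G →ₗ[ZMod p] K} {d : G → K} {φ : G → G → AddMonoidAlgebra ℝ G}
  {M : G →ₗ[ZMod p] G →ₗ[ZMod p] K} {T : G → G →ₗ[ZMod p] G} {H : G → Prop} {σ : ℝ}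

/-- If three values at heights `h₁`, `h₂` and `h₁ + h₂` are not additive, then at least one of the
defects is large. -/
theorem SimplexOn.colDens_mul_le (hφ : SimplexOn L d φ) {x x' h₁ h₂ a₁ a₂ a₃ : G}
    (hx₁ : L x h₁ = 0) (hx₂ : L x h₂ = 0) (hx₁' : L x' h₁ = 0) (hx₂' : L x' h₂ = 0)
    (hne : a₁ + a₂ ≠ a₃) :
    colDens L d x * colDens L d x' ≤
      defect φ h₁ x x' a₁ + defect φ h₂ x x' a₂ + defect φ (h₁ + h₂) x x' a₃ := by
  set Q : G → G → G → AddMonoidAlgebra ℝ G := fun h y y' =>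
    φ x y * adj (φ x (y + h)) * adj (φ x' y' * adj (φ x' (y' + h))) with hQ
  have hQ0 : ∀ h y y', IsNonneg (Q h y y') := fun h y y' =>
    ((hφ.isNonneg _ _).mul (hφ.isNonneg _ _).adj).mul
      ((hφ.isNonneg _ _).mul (hφ.isNonneg _ _).adj).adj
  have hdef : ∀ h a, defect φ h x x' a = 𝔼 y, 𝔼 y', (mass (Q h y y') - (Q h y y').coeff a) := by
    intro h a
    have : col φ h x * adj (col φ h x') = 𝔼 y, 𝔼 y', Q h y y' := by
      rw [col, col, adj_expect, Finset.expect_mul_expect]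
    simp only [defect, this, mass_expect, coeff_expect, Finset.expect_sub_distrib]
  -- Shifting both columns by h₁ puts the parallelogram of height h₂ on top of the one of height h₁.
  have hdef₂ : defect φ h₂ x x' a₂ = 𝔼 y, 𝔼 y', (mass (Q h₂ (y + h₁) (y' + h₁)) -
      (Q h₂ (y + h₁) (y' + h₁)).coeff a₂) := by
    rw [hdef, ← expect_add_right _ h₁]
    refine Finset.expect_congr rfl fun y _ => ?_
    rw [← expect_add_right _ h₁]
  have hcol : colDens L d x * colDens L d x' =
      𝔼 y, 𝔼 y', ind (L x y = d x) * ind (L x' y' = d x') := by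
    rw [colDens, colDens, prob_eq_expect_ind, prob_eq_expect_ind, Finset.expect_mul_expect]
  rw [hcol, hdef, hdef₂, hdef]
  simp only [← Finset.expect_add_distrib]
  refine expect_mono fun y => expect_mono fun y' => ?_
  by_cases hy : L x y = d x
  swap
  · rw [ind_neg hy, zero_mul]
    refine add_nonneg (add_nonneg ?_ ?_) ?_ <;> exact sub_nonneg.2 ((hQ0 _ _ _).coeff_le_mass _)
  by_cases hy' : L x' y' = d x'
  swap
  · rw [ind_neg hy', mul_zero]
    refine add_nonneg (add_nonneg ?_ ?_) ?_ <;> exact sub_nonneg.2 ((hQ0 _ _ _).coeff_le_mass _)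
  rw [ind_pos hy, ind_pos hy', one_mul]
  have hP : φ x y * adj (φ x' y') ∈ simplex G :=
    mul_adj_mem_simplex (hφ.mem _ _ hy) (hφ.mem _ _ hy')
  have hR : φ x (y + h₁) * adj (φ x' (y' + h₁)) ∈ simplex G :=
    mul_adj_mem_simplex (hφ.mem _ _ (by rw [map_add, hx₁, add_zero, hy]))
      (hφ.mem _ _ (by rw [map_add, hx₁', add_zero, hy']))
  have hS : φ x (y + (h₁ + h₂)) * adj (φ x' (y' + (h₁ + h₂))) ∈ simplex G :=
    mul_adj_mem_simplex (hφ.mem _ _ (by rw [map_add, map_add, hx₁, hx₂, add_zero, add_zero, hy]))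
      (hφ.mem _ _ (by rw [map_add, map_add, hx₁', hx₂', add_zero, add_zero, hy']))
  have hQe : ∀ h y y', Q h y y' =
      φ x y * adj (φ x' y') * adj (φ x (y + h) * adj (φ x' (y' + h))) := fun h y y' => by
    simp only [hQ, adj_mul, adj_adj]
    ring
  -- The triangle inequality through the middle level gives a₁ + a₂ as the difference between bottom
  -- and top, which competes for mass with a₃. The three coefficients therefore sum to at most 2,
  -- and the three defects to at least 1.
  have t := coeff_mul_adj_triangle hP hS hR a₁ a₂
  have hm₁ := (mul_adj_mem_simplex hP hR).2
  have hm₂ := (mul_adj_mem_simplex hR hS).2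
  have hm₃ := mul_adj_mem_simplex hP hS
  have hsep := IsNonneg.coeff_add_coeff_le hm₃.1 hne
  rw [hQe h₁ y y', hQe h₂ (y + h₁) (y' + h₁), hQe (h₁ + h₂) y y', add_assoc y h₁ h₂,
    add_assoc y' h₁ h₂, hm₁, hm₂, hm₃.2]
  rw [hm₃.2] at hsep
  linarith

/-- The indicator of the event that `x` and `x'` both lie in the rows `h` and `h'`. -/
def rowInd (L : G → G →ₗ[ZMod p] K) (h h' x x' : G) : ℝ :=
  ind (L x h = 0 ∧ L x' h = 0 ∧ L x h' = 0 ∧ L x' h' = 0)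

/-- The defect of the linear maps `T h` with `h` in `H`. -/
def rowDefect (φ : G → G → AddMonoidAlgebra ℝ G) (H : G → Prop) (T : G → G →ₗ[ZMod p] G)
    (h x x' : G) : ℝ :=
  ind (H h) * defect φ h x x' (T h (x' - x))

theorem SimplexOn.rowDefect_nonneg (hφ : SimplexOn L d φ) (h x x' : G) :
    0 ≤ rowDefect φ H T h x x' :=
  mul_nonneg (ind_nonneg _) (hφ.defect_nonneg _ _ _ _)

theorem SimplexOn.rowDefect_le_one (hφ : SimplexOn L d φ) (h x x' : G) :
    rowDefect φ H T h x x' ≤ 1 :=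
  mul_le_one₀ (ind_le_one _) (hφ.defect_nonneg _ _ _ _) (hφ.defect_le_one _ _ _ _)

/-- On the common kernel, of density q², additivity holds on a proper subgroup. Translation by a
point w₀ of failure carries that subgroup into its complement. -/
theorem half_le_prob_not_addAt {h₁ h₂ : G} (hJ : JointlyOnto (M h₁) (M h₂))
    (hT : ¬ AddAt M T h₁ h₂) :
    dens K ^ 2 / 2 ≤
      prob fun w => (M h₁ w = 0 ∧ M h₂ w = 0) ∧ T h₁ w + T h₂ w ≠ T (h₁ + h₂) w := by
  obtain ⟨w₀, hw₁, hw₂, hw₃⟩ : ∃ w₀, M h₁ w₀ = 0 ∧ M h₂ w₀ = 0 ∧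
      T h₁ w₀ + T h₂ w₀ ≠ T (h₁ + h₂) w₀ := by
    by_contra! hcon
    exact hT hcon
  set Q : G → Prop := fun w => (M h₁ w = 0 ∧ M h₂ w = 0) ∧ T h₁ w + T h₂ w ≠ T (h₁ + h₂) w
  have h1 : prob (fun w => M h₁ w = 0 ∧ M h₂ w = 0) ≤ prob Q + prob fun w => Q (w + w₀) := by
    refine le_trans (prob_mono fun w hw => ?_) (prob_or_le _ _)
    by_contra! hcon
    have e₁ : T h₁ w + T h₂ w = T (h₁ + h₂) w := by
      by_contra hne
      exact hcon.1 ⟨hw, hne⟩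
    have e₂ : T h₁ (w + w₀) + T h₂ (w + w₀) = T (h₁ + h₂) (w + w₀) := by
      by_contra hne
      exact hcon.2 ⟨⟨by simp [hw.1, hw₁], by simp [hw.2, hw₂]⟩, hne⟩
    simp only [map_add (T _)] at e₂
    rw [← e₁] at e₂
    refine hw₃ (add_left_cancel (a := T h₁ w + T h₂ w) ?_)
    rw [← e₂]
    abel
  have h2 : prob (fun w => Q (w + w₀)) = prob Q := prob_equiv (Equiv.addRight w₀) Q
  rw [prob_pair_eq hJ, h2] at h1
  linarith

/-- Choosing x in both rows has density q², and x' - x is a point of failure with probability at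
least q²/2. By `colDens_mul_le` each such pair contributes q², up to degenerate points. -/
theorem SimplexOn.le_expect_rowDefect (hφ : SimplexOn L d φ)
    (hLM : ∀ x w h, L (x + w) h = L x h + M h w) (hL : MostlyOnto L σ) {h₁ h₂ : G}
    (hH₁ : H h₁) (hH₂ : H h₂) (hH₃ : H (h₁ + h₂)) (hJ : JointlyOnto (M h₁) (M h₂))
    (hT : ¬ AddAt M T h₁ h₂) :
    dens K ^ 6 / 2 - 2 * σ ≤ 𝔼 x, 𝔼 x', rowInd L h₁ h₂ x x' *
      (rowDefect φ H T h₁ x x' + rowDefect φ H T h₂ x x' + rowDefect φ H T (h₁ + h₂) x x') := by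
  have hq := dens_pos K
  set Q : G → Prop := fun w => (M h₁ w = 0 ∧ M h₂ w = 0) ∧ T h₁ w + T h₂ w ≠ T (h₁ + h₂) w
  have hQ : dens K ^ 2 / 2 ≤ prob Q := half_le_prob_not_addAt hJ hT
  have hx : prob (fun x => L x h₁ = 0 ∧ L x h₂ = 0) = dens K ^ 2 := by
    rw [← prob_pair_eq hJ (-L 0 h₁) (-L 0 h₂)]
    congr 1
    ext x
    have e₁ := hLM 0 x h₁
    have e₂ := hLM 0 x h₂
    rw [zero_add] at e₁ e₂
    rw [e₁, e₂, add_comm, add_eq_zero_iff_eq_neg, add_comm, add_eq_zero_iff_eq_neg]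
  have hpt : ∀ x x', dens K ^ 2 * (ind (L x h₁ = 0 ∧ L x h₂ = 0) * ind (Q (x' - x))) -
      (ind (Degenerate L x) + ind (Degenerate L x')) ≤ rowInd L h₁ h₂ x x' *
      (rowDefect φ H T h₁ x x' + rowDefect φ H T h₂ x x' + rowDefect φ H T (h₁ + h₂) x x') := by
    intro x x'
    have i1 := ind_nonneg (Degenerate L x)
    have i2 := ind_nonneg (Degenerate L x')
    have hr : 0 ≤ rowInd L h₁ h₂ x x' * (rowDefect φ H T h₁ x x' + rowDefect φ H T h₂ x x' +
        rowDefect φ H T (h₁ + h₂) x x') :=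
      mul_nonneg (ind_nonneg _) (add_nonneg (add_nonneg (hφ.rowDefect_nonneg _ _ _)
        (hφ.rowDefect_nonneg _ _ _)) (hφ.rowDefect_nonneg _ _ _))
    by_cases hs : (L x h₁ = 0 ∧ L x h₂ = 0) ∧ Q (x' - x)
    swap
    · rw [← ind_and, ind_neg hs, mul_zero]
      linarith
    rw [← ind_and, ind_pos hs, mul_one]
    obtain ⟨⟨s₁, s₂⟩, ⟨v₁, v₂⟩, hne⟩ := hs
    have s₁' : L x' h₁ = 0 := by
      have := hLM x (x' - x) h₁
      rwa [add_sub_cancel, s₁, v₁, add_zero] at this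
    have s₂' : L x' h₂ = 0 := by
      have := hLM x (x' - x) h₂
      rwa [add_sub_cancel, s₂, v₂, add_zero] at this
    have hc := hφ.colDens_mul_le s₁ s₂ s₁' s₂' hne
    have ha := (abs_le.1 (abs_colDens_mul_sub_le (L := L) (d := d) x x')).1
    have hs : L x h₁ = 0 ∧ L x' h₁ = 0 ∧ L x h₂ = 0 ∧ L x' h₂ = 0 := ⟨s₁, s₁', s₂, s₂'⟩
    rw [rowInd, ind_pos hs, one_mul, rowDefect, rowDefect, rowDefect, ind_pos hH₁,
      ind_pos hH₂, ind_pos hH₃, one_mul, one_mul, one_mul]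
    linarith
  refine le_trans ?_ (expect_mono fun x => expect_mono fun x' => hpt x x')
  have h2 : 𝔼 x, ind (Degenerate L x) ≤ σ := hL.prob_top
  have h3 : 𝔼 x, 𝔼 x', dens K ^ 2 * (ind (L x h₁ = 0 ∧ L x h₂ = 0) * ind (Q (x' - x))) =
      dens K ^ 2 * (dens K ^ 2 * prob Q) := by
    simp only [← Finset.mul_expect]
    have : ∀ x, 𝔼 x', ind (Q (x' - x)) = prob Q := fun x => prob_equiv (Equiv.subRight x) Q
    simp only [this, ← Finset.expect_mul]
    rw [← prob_eq_expect_ind, hx]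
  simp only [Finset.expect_sub_distrib, Finset.expect_add_distrib, Fintype.expect_const]
  rw [h3]
  have h4 : dens K ^ 4 * (dens K ^ 2 / 2) ≤ dens K ^ 4 * prob Q :=
    mul_le_mul_of_nonneg_left hQ (by positivity)
  have e1 : dens K ^ 2 * (dens K ^ 2 * prob Q) = dens K ^ 4 * prob Q := by ring
  have e2 : dens K ^ 4 * (dens K ^ 2 / 2) = dens K ^ 6 / 2 := by ring
  linarith

/-- For fixed x and x' the requirement that both lie in row h' gains a factor q², unless `L x` and
`L x'` are not jointly onto. -/
theorem SimplexOn.expect_rowInd_mul_le (hφ : SimplexOn L d φ) (hL : MostlyOnto L σ) :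
    𝔼 h, 𝔼 h', 𝔼 x, 𝔼 x', rowInd L h h' x x' * rowDefect φ H T h x x' ≤
      dens K ^ 2 * (𝔼 h, 𝔼 x, 𝔼 x', rowDefect φ H T h x x') + 2 * σ := by
  have h1 : ∀ h x x', 𝔼 h', rowInd L h h' x x' * rowDefect φ H T h x x' ≤
      dens K ^ 2 * rowDefect φ H T h x x' + ind (¬ JointlyOnto (L x) (L x')) := by
    intro h x x'
    have d0 := hφ.rowDefect_nonneg (H := H) (T := T) h x x'
    have d1 := hφ.rowDefect_le_one (H := H) (T := T) h x x'
    rw [← Finset.expect_mul]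
    have hle : 𝔼 h', rowInd L h h' x x' ≤ prob fun h' => L x h' = 0 ∧ L x' h' = 0 :=
      expect_mono fun h' => ind_mono fun hh => hh.2.2
    have hle' := mul_le_mul_of_nonneg_right hle d0
    refine hle'.trans ?_
    by_cases hJ : JointlyOnto (L x) (L x')
    · rw [prob_pair_eq hJ]
      linarith [ind_nonneg (¬ JointlyOnto (L x) (L x'))]
    · rw [ind_pos hJ]
      have := mul_le_one₀ (prob_le_one fun h' => L x h' = 0 ∧ L x' h' = 0) d0 d1
      have := mul_nonneg (sq_nonneg (dens K)) d0
      linarith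
  calc 𝔼 h, 𝔼 h', 𝔼 x, 𝔼 x', rowInd L h h' x x' * rowDefect φ H T h x x'
      = 𝔼 h, 𝔼 x, 𝔼 x', 𝔼 h', rowInd L h h' x x' * rowDefect φ H T h x x' := by
        refine Finset.expect_congr rfl fun h _ => ?_
        rw [expect_comm']
        exact Finset.expect_congr rfl fun x _ => expect_comm' _
    _ ≤ 𝔼 h, 𝔼 x, 𝔼 x', (dens K ^ 2 * rowDefect φ H T h x x' +
          ind (¬ JointlyOnto (L x) (L x'))) :=
        expect_mono fun h => expect_mono fun x => expect_mono fun x' => h1 h x x'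
    _ ≤ _ := by
        simp only [Finset.expect_add_distrib, Fintype.expect_const, Finset.mul_expect]
        linarith [hL.expect_not_jointlyOnto]

theorem rowInd_symm (h h' x x' : G) : rowInd L h h' x x' = rowInd L h' h x x' := by
  rw [rowInd, rowInd]
  congr 1
  exact propext ⟨fun ⟨a, b, c, e⟩ => ⟨c, e, a, b⟩, fun ⟨a, b, c, e⟩ => ⟨c, e, a, b⟩⟩

/-- This lets the defect at height h + h' be averaged by the same bound as the other two. -/
theorem rowInd_add (h h' x x' : G) : rowInd L h h' x x' = rowInd L (h + h') h x x' := by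
  rw [rowInd, rowInd]
  congr 1
  refine propext ⟨fun ⟨a, b, c, e⟩ => ⟨by simp [a, c], by simp [b, e], a, b⟩,
    fun ⟨a, b, c, e⟩ => ⟨c, e, ?_, ?_⟩⟩
  · simpa [c] using a
  · simpa [e] using b

/-- The linear maps `T h` are additive in `h` at most pairs. -/
theorem SimplexOn.prob_not_addAt_le (hφ : SimplexOn L d φ)
    (hLM : ∀ x w h, L (x + w) h = L x h + M h w) (hL : MostlyOnto L σ)
    (hM : MostlyOnto (fun h => M h) σ) {ε : ℝ} (hσ : 2 * σ ≤ dens K ^ 6 / 2)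
    (hε : 𝔼 h, ind (H h) * (𝔼 x, 𝔼 x', defect φ h x x' (T h (x' - x))) ≤ ε) :
    (dens K ^ 6 / 2 - 2 * σ) *
      (prob (fun z : G × G => ¬ AddAt M T z.1 z.2) - 3 * prob (fun h => ¬ H h) - 2 * σ) ≤
      3 * (dens K ^ 2 * ε + 2 * σ) := by
  let Q : G × G → Prop := fun z => (H z.1 ∧ H z.2 ∧ H (z.1 + z.2) ∧
    JointlyOnto (M z.1) (M z.2)) ∧ ¬ AddAt M T z.1 z.2
  have h1 : prob (fun z : G × G => ¬ AddAt M T z.1 z.2) ≤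
      3 * prob (fun h => ¬ H h) + 2 * σ + prob Q := by
    have k1 : prob (fun z : G × G => ¬ H z.1) = prob fun h => ¬ H h := by
      rw [prob_prod (κ := G) fun a _ => ¬ H a]
      simp only [prob]
      rw [expect_comm', Fintype.expect_const]
    have k2 : prob (fun z : G × G => ¬ H z.2) = prob fun h => ¬ H h := by
      rw [prob_prod (ι := G) fun _ b => ¬ H b, Fintype.expect_const]
    have k3 : prob (fun z : G × G => ¬ H (z.1 + z.2)) = prob fun h => ¬ H h := by
      rw [prob_prod fun a b => ¬ H (a + b)]
      have : ∀ a, prob (fun b => ¬ H (a + b)) = prob fun h => ¬ H h := fun a =>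
        prob_equiv (Equiv.addLeft a) fun h => ¬ H h
      simp only [this, Fintype.expect_const]
    have k4 : prob (fun z : G × G => ¬ JointlyOnto (M z.1) (M z.2)) ≤ 2 * σ := by
      rw [prob_prod fun a b => ¬ JointlyOnto (M a) (M b)]
      exact hM.expect_not_jointlyOnto
    have k5 : prob (fun z : G × G => ¬ AddAt M T z.1 z.2) ≤ prob (fun z : G × G => ¬ H z.1) +
        (prob (fun z : G × G => ¬ H z.2) + (prob (fun z : G × G => ¬ H (z.1 + z.2)) +
          (prob (fun z : G × G => ¬ JointlyOnto (M z.1) (M z.2)) + prob Q))) := by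
      refine le_trans (prob_mono fun z hz => ?_) ((prob_or_le _ _).trans (add_le_add le_rfl
        ((prob_or_le _ _).trans (add_le_add le_rfl ((prob_or_le _ _).trans (add_le_add le_rfl
          (prob_or_le _ _)))))))
      by_contra! hcon
      exact hcon.2.2.2.2 ⟨⟨hcon.1, hcon.2.1, hcon.2.2.1, hcon.2.2.2.1⟩, hz⟩
    linarith
  set U : G → G → ℝ := fun h h' => 𝔼 x, 𝔼 x', rowInd L h h' x x' * rowDefect φ H T h x x' with hU
  have hU0 : ∀ h h', 0 ≤ U h h' := fun h h' => expect_nonneg' fun x => expect_nonneg' fun x' =>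
    mul_nonneg (ind_nonneg _) (hφ.rowDefect_nonneg _ _ _)
  have hUε : 𝔼 h, 𝔼 h', U h h' ≤ dens K ^ 2 * ε + 2 * σ := by
    refine (hφ.expect_rowInd_mul_le hL).trans ?_
    refine add_le_add (mul_le_mul_of_nonneg_left (le_trans (le_of_eq ?_) hε) (sq_nonneg _)) le_rfl
    simp only [rowDefect, Finset.mul_expect]
  have h2 : (dens K ^ 6 / 2 - 2 * σ) * prob Q ≤
      𝔼 z : G × G, (U z.1 z.2 + U z.2 z.1 + U (z.1 + z.2) z.1) := by
    refine mul_prob_le_expect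
      (fun z => add_nonneg (add_nonneg (hU0 _ _) (hU0 _ _)) (hU0 _ _)) ?_
    rintro ⟨a, b⟩ ⟨⟨q₁, q₂, q₃, q₄⟩, q₅⟩
    refine (hφ.le_expect_rowDefect hLM hL q₁ q₂ q₃ q₄ q₅).trans (le_of_eq ?_)
    simp only [hU, ← rowInd_add, rowInd_symm b a, mul_add, Finset.expect_add_distrib]
  have h3 : 𝔼 z : G × G, (U z.1 z.2 + U z.2 z.1 + U (z.1 + z.2) z.1) =
      3 * 𝔼 h, 𝔼 h', U h h' := by
    rw [expect_prod fun a b => U a b + U b a + U (a + b) a]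
    simp only [Finset.expect_add_distrib]
    rw [expect_comm' fun a b => U b a]
    have : 𝔼 a, 𝔼 b, U (a + b) a = 𝔼 h, 𝔼 h', U h h' := by
      rw [expect_comm' fun h h' => U h h']
      exact Finset.expect_congr rfl fun a _ => expect_add_left (fun b => U b a) a
    rw [this]
    ring
  have h4 : (dens K ^ 6 / 2 - 2 * σ) * (prob (fun z : G × G => ¬ AddAt M T z.1 z.2) -
      3 * prob (fun h => ¬ H h) - 2 * σ) ≤ (dens K ^ 6 / 2 - 2 * σ) * prob Q :=
    mul_le_mul_of_nonneg_left (by linarith) (by linarith)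
  linarith

end Pairs

/-! ### Assembling the stability theorem for families of linear maps. -/

section Main

open Module

variable {p : ℕ} [Fact p.Prime] {G K : Type*} [AddCommGroup G] [Module (ZMod p) G] [Fintype G]
  [AddCommGroup K] [Module (ZMod p) K] [Fintype K]
  {L : G → G →ₗ[ZMod p] K} {d : G → K} {φ : G → G → AddMonoidAlgebra ℝ G}
  {M : G →ₗ[ZMod p] G →ₗ[ZMod p] K} {σ η : ℝ}

/-- This bounds the whole mass of a row, which is what an exceptional row is charged. -/
theorem SimplexOn.expect_mass_col_mul_le (hφ : SimplexOn L d φ)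
    (hLM : ∀ x w h, L (x + w) h = L x h + M h w) (hL : MostlyOnto L σ) (h : G) :
    𝔼 x, 𝔼 x', mass (col φ h x * adj (col φ h x')) ≤
      (dens K ^ 2 + σ) ^ 2 + ind (Degenerate (fun h => M h) h) := by
  have hq := dens_pos K
  have h0 : 𝔼 x, 𝔼 x', mass (col φ h x * adj (col φ h x')) =
      (𝔼 x, mass (col φ h x)) ^ 2 := by
    rw [pow_two, Finset.expect_mul_expect]
    simp only [mass_mul, mass_adj]
  have hpos : 0 ≤ 𝔼 x, mass (col φ h x) :=
    expect_nonneg' fun x => (hφ.isNonneg_col h x).mass_nonneg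
  rw [h0]
  by_cases hh : Degenerate (fun h => M h) h
  · rw [ind_pos hh]
    have h1 : 𝔼 x, mass (col φ h x) ≤ 1 := expect_le_const fun x => by
      rw [hφ.mass_col]
      exact mul_le_one₀ (ind_le_one _) (colDens_nonneg _) (colDens_le_one _)
    have := pow_le_one₀ (n := 2) hpos h1
    have := sq_nonneg (dens K ^ 2 + σ)
    linarith
  · rw [ind_neg hh, add_zero]
    refine pow_le_pow_left₀ hpos ?_ 2
    have h2 : 𝔼 x, ind (Degenerate L x) ≤ σ := hL.prob_top
    calc 𝔼 x, mass (col φ h x)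
        ≤ 𝔼 x, (ind (L x h = 0) * dens K + ind (Degenerate L x)) := by
          refine expect_mono fun x => ?_
          rw [hφ.mass_col]
          have h1 := mul_le_mul_of_nonneg_left (colDens_le (L := L) (d := d) x)
            (ind_nonneg (L x h = 0))
          have h3 : ind (L x h = 0) * ind (Degenerate L x) ≤ ind (Degenerate L x) :=
            mul_le_of_le_one_left (ind_nonneg _) (ind_le_one _)
          linarith
      _ ≤ dens K ^ 2 + σ := by
          rw [Finset.expect_add_distrib, ← Finset.expect_mul, ← prob_eq_expect_ind,
            prob_apply_eq_zero hLM hh, pow_two]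
          linarith

/-- Stability of approximate bihomomorphisms on a set whose rows and columns are the fibres of
linear maps most of which are jointly onto. -/
theorem SimplexOn.exists_addAt_expect_le (hφ : SimplexOn L d φ)
    (hLM : ∀ x w h, L (x + w) h = L x h + M h w) (hL : MostlyOnto L σ)
    (hM : MostlyOnto (fun h => M h) σ) (hη0 : 0 ≤ η) (hη : η < 1 / 400)
    (hσ : σ ≤ η * dens K ^ 12 / 1000000)
    (h : (1 - η) * (𝔼 w, 𝔼 h, mass (mixedConv φ w h) ^ 2) ≤
      𝔼 w, 𝔼 h, innerSum (mixedConv φ w h) (mixedConv φ w h)) :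
    ∃ A : G → G →ₗ[ZMod p] G, (∀ h h', AddAt M A h h') ∧
      𝔼 w, 𝔼 h, ind (M h w = 0) *
        (mass (mixedConv φ w h) - (mixedConv φ w h).coeff (A h w)) ≤ 128 * η * dens K ^ 4 := by
  have hq := dens_pos K
  have hq1 := dens_le_one K
  have hσ0 : 0 ≤ σ := (prob_nonneg _).trans hL.prob_top
  have hpow : ∀ m, m ≤ 12 → σ ≤ η * dens K ^ m / 1000000 := fun m hm => hσ.trans (by
    have := mul_le_mul_of_nonneg_left (pow_le_pow_of_le_one hq.le hq1 hm) hη0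
    linarith)
  obtain ⟨g, hg⟩ := hφ.exists_expect_defect_le hLM hL hM hη0 (by linarith) h
  have hg' : 𝔼 h, 𝔼 x, 𝔼 x', defect φ h x x' (g h (x' - x)) ≤
      100001 / 100000 * (η * dens K ^ 4) := by
    refine le_of_mul_le_mul_left (hg.trans ?_) (pow_pos hq 3)
    have := hpow 7 (by norm_num)
    have e : dens K ^ 3 * (100001 / 100000 * (η * dens K ^ 4)) =
        100001 / 100000 * (η * dens K ^ 7) := by ring
    rw [e]
    linarith
  obtain ⟨H, T, hH, hHd, hT⟩ := hφ.exists_linearMap_family hLM hL hM hg'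
  have hσ4 := hpow 4 (by norm_num)
  have hq4 : 0 < dens K ^ 4 := pow_pos hq 4
  have hq6 : 0 < dens K ^ 6 := pow_pos hq 6
  have hHη : prob (fun h => ¬ H h) ≤ 6001 / 1000 * η := by
    refine le_of_mul_le_mul_left (hH.trans ?_) (by positivity : 0 < dens K ^ 4 / 6)
    have := mul_nonneg hη0 hq4.le
    linarith
  have hT' : 𝔼 h, ind (H h) * (𝔼 x, 𝔼 x', defect φ h x x' (T h (x' - x))) ≤
      10001 / 10000 * (η * dens K ^ 4) := by
    have := mul_nonneg hη0 hq4.le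
    linarith
  have hσ6 := hpow 6 (by norm_num)
  have hσ1 := hpow 0 (by norm_num)
  rw [pow_zero, mul_one] at hσ1
  have hηq6 : η * dens K ^ 6 ≤ 1 / 400 * dens K ^ 6 :=
    mul_le_mul_of_nonneg_right hη.le hq6.le
  have hpair := hφ.prob_not_addAt_le hLM hL hM (by linarith) hT'
  -- Discarded rows account for 3 · 6η and double counting for 3q⁶η / (q⁶/2) = 6η. Since η < 1/400,
  -- the result is below the 61/1000 needed for the correction.
  have hρ : prob (fun z : G × G => ¬ AddAt M T z.1 z.2) ≤ 241 / 10 * η := by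
    set X := prob (fun z : G × G => ¬ AddAt M T z.1 z.2) - 3 * prob (fun h => ¬ H h) - 2 * σ
      with hX
    have hXη : X ≤ 601 / 100 * η := by
      by_contra! hcon
      have hX0 : 0 ≤ X := (by positivity : 0 ≤ 601 / 100 * η).trans hcon.le
      have h1 : 4999 / 10000 * dens K ^ 6 * X ≤ (dens K ^ 6 / 2 - 2 * σ) * X :=
        mul_le_mul_of_nonneg_right (by linarith) hX0
      have h2 : 3 * (dens K ^ 2 * (10001 / 10000 * (η * dens K ^ 4)) + 2 * σ) ≤
          dens K ^ 6 * (3001 / 1000 * η) := by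
        have e : dens K ^ 2 * (10001 / 10000 * (η * dens K ^ 4)) =
          10001 / 10000 * (η * dens K ^ 6) := by ring
        rw [e]
        have := mul_nonneg hη0 hq6.le
        linarith
      have h3 : dens K ^ 6 * (4999 / 10000 * X) ≤ dens K ^ 6 * (3001 / 1000 * η) := by linarith
      have h4 := le_of_mul_le_mul_left h3 hq6
      linarith
    linarith
  obtain ⟨A, hA, hAT⟩ := exists_addAt_of_prob hM hρ (by linarith) (by linarith) hσ0
  refine ⟨A, hA, ?_⟩
  let Q : G → Prop := fun h => ¬ H h ∨ ¬ ∀ w, M h w = 0 → A h w = T h w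
  -- Discarded rows contribute 6.001η and corrected rows (10/7) · 24.1η.
  have hQ : prob Q ≤ 41 * η := by
    have := prob_or_le (fun h => ¬ H h) fun h => ¬ ∀ w, M h w = 0 → A h w = T h w
    linarith
  have hrow : ∀ h, 𝔼 x, 𝔼 x', ind (M h (x' - x) = 0) * defect φ h x x' (A h (x' - x)) ≤
      ind (H h) * (𝔼 x, 𝔼 x', defect φ h x x' (T h (x' - x))) +
        (ind (Q h) * (dens K ^ 2 + σ) ^ 2 + ind (Degenerate (fun h => M h) h)) := by
    intro h
    have i1 := ind_nonneg (Degenerate (fun h => M h) h)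
    have i2 : 0 ≤ 𝔼 x, 𝔼 x', defect φ h x x' (T h (x' - x)) :=
      expect_nonneg' fun x => expect_nonneg' fun x' => hφ.defect_nonneg _ _ _ _
    by_cases hQh : Q h
    · rw [ind_pos hQh, one_mul]
      have h1 : 𝔼 x, 𝔼 x', ind (M h (x' - x) = 0) * defect φ h x x' (A h (x' - x)) ≤
          𝔼 x, 𝔼 x', mass (col φ h x * adj (col φ h x')) :=
        expect_mono fun x => expect_mono fun x' =>
          (mul_le_of_le_one_left (hφ.defect_nonneg _ _ _ _) (ind_le_one _)).trans
            (hφ.defect_le_mass _ _ _ _)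
      have := hφ.expect_mass_col_mul_le hLM hL h
      have := mul_nonneg (ind_nonneg (H h)) i2
      linarith
    · have hQh' : H h ∧ ∀ w, M h w = 0 → A h w = T h w := by
        by_contra hcon
        exact hQh (not_and_or.1 hcon)
      rw [ind_neg hQh, zero_mul, zero_add, ind_pos hQh'.1, one_mul]
      refine le_add_of_le_of_nonneg (expect_mono fun x => expect_mono fun x' => ?_) i1
      by_cases hw : M h (x' - x) = 0
      · rw [ind_pos hw, one_mul, hQh'.2 _ hw]
      · rw [ind_neg hw, zero_mul]
        exact hφ.defect_nonneg _ _ _ _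
  have hsq : (dens K ^ 2 + σ) ^ 2 ≤ 101 / 100 * dens K ^ 4 := by
    have h2 := hpow 2 (by norm_num)
    have h3 : η * dens K ^ 2 ≤ 1 * dens K ^ 2 :=
      mul_le_mul_of_nonneg_right (by linarith) (sq_nonneg _)
    have h4 : dens K ^ 2 + σ ≤ 1001 / 1000 * dens K ^ 2 := by linarith
    calc (dens K ^ 2 + σ) ^ 2 ≤ (1001 / 1000 * dens K ^ 2) ^ 2 :=
          pow_le_pow_left₀ (by positivity) h4 2
      _ = (1001 / 1000) ^ 2 * dens K ^ 4 := by ring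
      _ ≤ _ := mul_le_mul_of_nonneg_right (by norm_num) hq4.le
  have hfin : 𝔼 w, 𝔼 h, ind (M h w = 0) *
      (mass (mixedConv φ w h) - (mixedConv φ w h).coeff (A h w)) =
      𝔼 h, 𝔼 x, 𝔼 x', ind (M h (x' - x) = 0) * defect φ h x x' (A h (x' - x)) := by
    rw [expect_comm']
    refine Finset.expect_congr rfl fun h _ => ?_
    simp only [mass_sub_coeff_mixedConv, Finset.mul_expect]
    rw [expect_comm']
    refine Finset.expect_congr rfl fun x _ => ?_
    rw [← expect_add_left (fun x' => ind (M h (x' - x) = 0) * defect φ h x x' (A h (x' - x))) x]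
    simp only [add_sub_cancel_left]
  rw [hfin]
  refine (expect_mono hrow).trans ?_
  rw [Finset.expect_add_distrib, Finset.expect_add_distrib, ← Finset.expect_mul]
  have hdeg : 𝔼 h, ind (Degenerate (fun h => M h) h) ≤ σ := hM.prob_top
  have hmul : (𝔼 h, ind (Q h)) * (dens K ^ 2 + σ) ^ 2 ≤ 41 * η * (101 / 100 * dens K ^ 4) :=
    mul_le_mul hQ hsq (sq_nonneg _) (by positivity)
  have := mul_nonneg hη0 hq4.le
  linarith

end Main

/-! ### From the rank of a bi-affine map to generic surjectivity, and the conclusion. -/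

section BiAffine

open Module

variable {p n k : ℕ} [Fact p.Prime] {η : ℝ}

/-- Take logarithms: log P ≥ 1/2, so 9 log(1/η) log P is more than enough to cover log(1/η). -/
theorem inv_pow_le_of_log_le {P : ℝ} (hP : 2 ≤ P) {η : ℝ} (hη0 : 0 < η) (hη1 : η ≤ 1) {k t : ℕ}
    (h : 60 * (k : ℝ) + 9 * Real.log η⁻¹ ≤ t) : (P ^ t)⁻¹ ≤ η * (P ^ (60 * k))⁻¹ := by
  have hP0 : 0 < P := by linarith
  have hlogη : 0 ≤ Real.log η⁻¹ := Real.log_nonneg ((one_le_inv₀ hη0).2 hη1)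
  have hlogP : 1 / 2 ≤ Real.log P := by
    have := Real.log_two_gt_d9
    have := Real.log_le_log (by norm_num) hP
    linarith
  rw [← Real.log_le_log_iff (by positivity) (by positivity), Real.log_mul hη0.ne' (by positivity),
    Real.log_inv, Real.log_inv, Real.log_pow, Real.log_pow]
  rw [Real.log_inv] at h hlogη
  push_cast
  have h1 := mul_le_mul_of_nonneg_right h (by linarith : 0 ≤ Real.log P)
  have h2 : -Real.log η * (1 / 2) ≤ -Real.log η * Real.log P :=
    mul_le_mul_of_nonneg_left hlogP hlogη
  linarith

theorem finrank_ker_le_of_rank (β : BiAffineMap p n k) (hη0 : 0 ≤ η) (hη : η ≤ 1)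
    (hrank : ((60 * (k : ℝ) : ℝ) : EReal) + 9 * ENNReal.log (ENNReal.ofReal η)⁻¹ ≤
      ((β.rank : ENNReal) : EReal)) (u : Fin k → ZMod p) (hu : u ≠ 0) :
    (p : ℝ) ^ finrank (ZMod p) (LinearMap.ker (β.form u)) ≤
      η * ((p : ℝ) ^ (60 * k))⁻¹ * Fintype.card (Fin n → ZMod p) := by
  have hp : (2 : ℝ) ≤ p := by exact_mod_cast (Fact.out : p.Prime).two_le
  set t := finrank (ZMod p) (LinearMap.range (β.form u)) with ht
  have hle : β.rank ≤ (t : ℕ∞) := iInf₂_le u hu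
  have hle' : ((60 * (k : ℝ) : ℝ) : EReal) + 9 * ENNReal.log (ENNReal.ofReal η)⁻¹ ≤
      ((t : ℝ) : EReal) := by
    refine hrank.trans ?_
    have : ((β.rank : ENNReal) : EReal) ≤ (((t : ℕ∞) : ENNReal) : EReal) := by
      exact_mod_cast hle
    refine this.trans (le_of_eq ?_)
    rw [ENat.toENNReal_coe, ← ENNReal.ofReal_natCast, EReal.coe_ennreal_ofReal,
      max_eq_left (Nat.cast_nonneg t)]
  -- If η = 0 the rank bound is infinite, while the form attached to a nonzero u has finite rank.
  have hη' : 0 < η := by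
    rcases hη0.eq_or_lt with rfl | h
    · exfalso
      have h9 : (9 : EReal) * ⊤ = ⊤ := EReal.mul_top_of_pos (by norm_num)
      simp only [ENNReal.ofReal_zero, ENNReal.inv_zero, ENNReal.log_top, h9,
        EReal.coe_add_top] at hle'
      exact (EReal.coe_lt_top _).not_ge hle'
    · exact h
  have hreal : 60 * (k : ℝ) + 9 * Real.log η⁻¹ ≤ t := by
    rw [← ENNReal.ofReal_inv_of_pos hη', ENNReal.log_ofReal_of_pos (inv_pos.2 hη')] at hle'
    rw [← EReal.coe_le_coe_iff, EReal.coe_add, EReal.coe_mul 9]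
    exact hle'
  have hmain := inv_pow_le_of_log_le hp hη' hη hreal
  have hdim := LinearMap.finrank_range_add_finrank_ker (β.form u)
  rw [← Nat.card_eq_fintype_card, Module.natCard_eq_pow_finrank (K := ZMod p), Nat.card_zmod,
    ← hdim, ← ht, pow_add, Nat.cast_mul, Nat.cast_pow, Nat.cast_pow, ← mul_assoc]
  have hpt : (0 : ℝ) < (p : ℝ) ^ t := by positivity
  refine le_mul_of_one_le_left (by positivity) ?_
  rw [inv_le_iff_one_le_mul₀ hpt] at hmain
  exact hmain

theorem mostlyOnto_of_finrank_ker_le (γ : (Fin n → ZMod p) →ₗ[ZMod p] (Fin n → ZMod p) →ₗ[ZMod p]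
    (Fin k → ZMod p)) (C : (Fin n → ZMod p) →ₗ[ZMod p] (Fin k → ZMod p)) (hη0 : 0 ≤ η)
    (hγ : ∀ u : Dual (ZMod p) (Fin k → ZMod p), u ≠ 0 →
      (p : ℝ) ^ finrank (ZMod p) (LinearMap.ker (γ.compr₂ u)) ≤
        η * ((p : ℝ) ^ (60 * k))⁻¹ * Fintype.card (Fin n → ZMod p)) :
    MostlyOnto (fun x => γ x + C) (η * dens (Fin k → ZMod p) ^ 12 / 1000000) := by
  intro W hW
  have hp : (2 : ℝ) ≤ p := by exact_mod_cast (Fact.out : p.Prime).two_le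
  rcases Nat.eq_zero_or_pos k with rfl | hk
  -- For k = 0 there is no nonzero functional, so τ = 0 is admissible; no power of p is available to
  -- absorb the constant 1000000.
  · refine (prob_map_ne_top_le γ C (τ := 0) le_rfl
      (fun u hu => absurd (Subsingleton.elim u 0) hu) W hW).trans ?_
    rw [mul_zero, mul_zero]
    have := dens_pos (Fin 0 → ZMod p)
    positivity
  · refine (prob_map_ne_top_le γ C (by positivity) hγ W hW).trans ?_
    have hd : dens (Fin k → ZMod p) = ((p : ℝ) ^ k)⁻¹ := by
      rw [dens, Fintype.card_fun, ZMod.card, Fintype.card_fin, Nat.cast_pow]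
    have hP : (2 : ℝ) ≤ (p : ℝ) ^ k :=
      hp.trans (le_self_pow₀ (by linarith) hk.ne')
    rw [hd, Module.finrank_fin_fun, mul_comm 7 k, mul_comm 60 k, pow_mul, pow_mul]
    generalize (p : ℝ) ^ k = P at *
    have hP0 : 0 < P := by linarith
    have h40 : (1000000 : ℝ) ≤ P ^ 40 :=
      le_trans (by norm_num) (pow_le_pow_left₀ (by norm_num) hP 40)
    -- The union bound costs P and the codimension P⁷. Of the remaining P⁻⁵², P⁻¹² is the required
    -- power of q and P⁻⁴⁰ ≤ 2⁻⁴⁰ beats 1/1000000.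
    have e : P * (P ^ 7 * (η * (P ^ 60)⁻¹)) = η * P⁻¹ ^ 12 * (P ^ 40)⁻¹ := by
      field_simp
    rw [e, div_eq_mul_inv]
    exact mul_le_mul_of_nonneg_left (inv_anti₀ (by norm_num) h40) (by positivity)

theorem BiAffineMap.mem_bohrSet_iff (β : BiAffineMap p n k) (z : Fin k → ZMod p)
    (x y : Fin n → ZMod p) :
    (x, y) ∈ β.bohrSet z ↔ (β.bilin x + β.right) y = z - β.const - β.left x := by
  simp only [bohrSet, Set.mem_ofPred_eq, eval, LinearMap.add_apply]
  constructor
  · rintro rfl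
    abel
  · intro h
    rw [add_right_comm (β.bilin x y), h]
    abel

theorem BiAffineMap.mem_mixedZeroSet_iff (β : BiAffineMap p n k) (w h : Fin n → ZMod p) :
    (w, h) ∈ β.mixedZeroSet ↔ β.bilin.flip h w = 0 := by
  have : β.mixedDeriv w h = β.bilin.flip h w := by
    simp only [mixedDeriv, vertDeriv, eval, map_zero, LinearMap.zero_apply, LinearMap.flip_apply]
    abel
  rw [← this]
  rfl

/-- Stability of approximate bihomomorphisms on bilinear Bohr sets of high rank. -/
theorem exists_sepAdditiveOn_expect_gdist_le (hη0 : 0 ≤ η) (hη : η < 1 / 400)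
    (β : BiAffineMap p n k) (z : Fin k → ZMod p)
    (hrank : ((60 * (k : ℝ) : ℝ) : EReal) + 9 * ENNReal.log (ENNReal.ofReal η)⁻¹ ≤
      ((β.rank : ℝ≥0∞) : EReal))
    (φ : (Fin n → ZMod p) → (Fin n → ZMod p) → AddMonoidAlgebra ℝ (Fin n → ZMod p))
    (hφB : ∀ x y, (x, y) ∈ β.bohrSet z → φ x y ∈ simplex (Fin n → ZMod p))
    (hφ0 : ∀ x y, (x, y) ∉ β.bohrSet z → φ x y = 0)
    (hφ : IsApproxBihom η (fun x y => (β.bohrSet z).indicator 1 (x, y)) φ) :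
    ∃ ψ₂ : (Fin n → ZMod p) → (Fin n → ZMod p) → (Fin n → ZMod p),
      SepAdditiveOn β.mixedZeroSet ψ₂ ∧
      (𝔼 w, 𝔼 h, gdist (mixedConv φ w h)
          (β.mixedZeroSet.indicator (fun q => delta (ψ₂ q.1 q.2)) (w, h))) ≤
        128 * η * ((p : ℝ) ^ (4 * k))⁻¹ := by
  have hS : SimplexOn (fun x => β.bilin x + β.right) (fun x => z - β.const - β.left x) φ :=
    ⟨fun x y hxy => hφB x y ((β.mem_bohrSet_iff z x y).2 hxy),
      fun x y hxy => hφ0 x y fun h => hxy ((β.mem_bohrSet_iff z x y).1 h)⟩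
  have hker : ∀ u : Module.Dual (ZMod p) (Fin k → ZMod p), u ≠ 0 →
      (p : ℝ) ^ Module.finrank (ZMod p) (LinearMap.ker (β.bilin.compr₂ u)) ≤
        η * ((p : ℝ) ^ (60 * k))⁻¹ * Fintype.card (Fin n → ZMod p) := by
    intro u hu
    obtain ⟨v, rfl⟩ := (dotProductEquiv (ZMod p) (Fin k)).surjective u
    exact finrank_ker_le_of_rank β hη0 (by linarith) hrank v fun hv => hu (by rw [hv, map_zero])
  have hL := mostlyOnto_of_finrank_ker_le β.bilin β.right hη0 hker
  -- Rows are governed by the flipped form, whose kernels have the same dimension; they carry no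
  -- affine term because `M` comes from the mixed derivative.
  have hM := mostlyOnto_of_finrank_ker_le β.bilin.flip 0 hη0 fun u hu => by
    rw [show β.bilin.flip.compr₂ u = (β.bilin.compr₂ u).flip from rfl, finrank_ker_flip]
    exact hker u hu
  simp only [add_zero] at hM
  have hμ : ∀ x y, (β.bohrSet z).indicator (1 : _ × _ → ℝ) (x, y) =
      ind ((β.bilin x + β.right) y = z - β.const - β.left x) := by
    intro x y
    by_cases hxy : (x, y) ∈ β.bohrSet z
    · rw [Set.indicator_of_mem hxy, ind_pos ((β.mem_bohrSet_iff z x y).1 hxy), Pi.one_apply]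
    · rw [Set.indicator_of_notMem hxy, ind_neg fun h => hxy ((β.mem_bohrSet_iff z x y).2 h)]
  rw [hS.isApproxBihom_iff hμ] at hφ
  obtain ⟨A, hA, hAle⟩ := hS.exists_addAt_expect_le (M := β.bilin.flip)
    (fun x w h => by simp only [map_add, LinearMap.add_apply, LinearMap.flip_apply]; abel)
    hL hM hη0 hη le_rfl hφ
  refine ⟨fun w h => A h w, ⟨fun w₁ w₂ h _ _ _ => map_add (A h) w₁ w₂, fun w h₁ h₂ hw₁ hw₂ _ =>
    (hA h₁ h₂ w ((β.mem_mixedZeroSet_iff w h₁).1 hw₁)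
      ((β.mem_mixedZeroSet_iff w h₂).1 hw₂)).symm⟩, ?_⟩
  have hd : dens (Fin k → ZMod p) ^ 4 = ((p : ℝ) ^ (4 * k))⁻¹ := by
    rw [dens, Fintype.card_fun, ZMod.card, Fintype.card_fin, Nat.cast_pow, inv_pow, ← pow_mul,
      mul_comm k 4]
  rw [← hd]
  refine le_trans (le_of_eq ?_) hAle
  refine Finset.expect_congr rfl fun w _ => Finset.expect_congr rfl fun h _ => ?_
  by_cases hw : (w, h) ∈ β.mixedZeroSet
  · rw [Set.indicator_of_mem hw, gdist_delta, ind_pos ((β.mem_mixedZeroSet_iff w h).1 hw), one_mul]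
  · rw [Set.indicator_of_notMem hw, gdist_zero,
      ind_neg fun hwh => hw ((β.mem_mixedZeroSet_iff w h).2 hwh), zero_mul]

end BiAffine

end BiStab

end

theorem mainTheorem5 (p n k : ℕ) [Fact p.Prime] (η : ℝ) (hη0 : 0 ≤ η) (hη : η < 1 / 400)
    (β : BiStab.BiAffineMap p n k) (z : Fin k → ZMod p)
    (hrank : ((60 * (k : ℝ) : ℝ) : EReal) + 9 * ENNReal.log (ENNReal.ofReal η)⁻¹ ≤
      ((β.rank : ℝ≥0∞) : EReal))
    (φ : (Fin n → ZMod p) → (Fin n → ZMod p) → AddMonoidAlgebra ℝ (Fin n → ZMod p))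
    (hφB : ∀ x y, (x, y) ∈ β.bohrSet z → φ x y ∈ BiStab.simplex (Fin n → ZMod p))
    (hφ0 : ∀ x y, (x, y) ∉ β.bohrSet z → φ x y = 0)
    (hφ : BiStab.IsApproxBihom η (fun x y => (β.bohrSet z).indicator 1 (x, y)) φ) :
    ∃ ψ₂ : (Fin n → ZMod p) → (Fin n → ZMod p) → (Fin n → ZMod p),
      BiStab.SepAdditiveOn β.mixedZeroSet ψ₂ ∧
      (𝔼 w, 𝔼 h, BiStab.gdist (BiStab.mixedConv φ w h)
          (β.mixedZeroSet.indicator (fun q => BiStab.delta (ψ₂ q.1 q.2)) (w, h))) ≤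
        128 * η * ((p : ℝ) ^ (4 * k))⁻¹ :=
  BiStab.exists_sepAdditiveOn_expect_gdist_le hη0 hη β z hrank φ hφB hφ0 hφ
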